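/- Let $1\le p<\infty$, let $H$ be a separable complex Hilbert space, and let $\mathcal S_p$ be the Schatten space of all compact operators $A$ on $H$ whose sequence of singular values $(s_i(A))_i$ lies in $\ell_p$, with the norm $\|A\|_p=\big(\sum_i s_i(A)^p\big)^{1/p}$. Let $T:\mathcal S_p\to\mathcal S_p$ be a bounded linear operator which is positive, that is, $TA\ge 0$ whenever $A\in\mathcal S_p$ and $A\ge 0$. Then the following are equivalent: 1. $T$ is compact. 2. $T$ is strictly singular, that is, there is no closed infinite-dimensional subspace $E\subset\mathcal S_p$ such that $T|_E$ is an isomorphism onto its image $T(E)$. 3. There is no subspace $E\subset\mathcal S_p$, isomorphic to $\ell_p$, such that $T|_E$ is an isomorphism onto its image and both $E$ and $T(E)$ are complemented in $\mathcal S_p$. -/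

import Mathlib

open scoped ENNReal

noncomputable section

namespace Schatten

open scoped InnerProductSpace
open Filter Topology

variable {H : Type*} [NormedAddCommGroup H] [InnerProductSpace ℂ H]

/-- The `n`-th singular value (counted from `0`) of a bounded operator `A` on a Hilbert space: the
distance from `A` to the operators of rank at most `n`. For compact `A` this is the non-increasing
sequence of the singular values (eigenvalues of `|A|`, with multiplicity, padded by zeros): see the
singular value decomposition `exists_schmidt`, whose coefficients are these numbers. -/
def singularValue (A : H →L[ℂ] H) (n : ℕ) : ℝ :=
  ⨅ F : {F : H →L[ℂ] H // LinearMap.rank (F : H →ₗ[ℂ] H) ≤ n}, ‖A - F‖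

theorem singularValue_nonneg (A : H →L[ℂ] H) (n : ℕ) : 0 ≤ singularValue A n :=
  Real.iInf_nonneg fun _ => norm_nonneg _

theorem singularValue_le (A F : H →L[ℂ] H) (n : ℕ)
    (hF : LinearMap.rank (F : H →ₗ[ℂ] H) ≤ n) : singularValue A n ≤ ‖A - F‖ :=
  ciInf_le (f := fun F : {F : H →L[ℂ] H // LinearMap.rank (F : H →ₗ[ℂ] H) ≤ n} => ‖A - F‖)
    ⟨0, by rintro _ ⟨F, rfl⟩; exact norm_nonneg _⟩ ⟨F, hF⟩

theorem le_singularValue (A : H →L[ℂ] H) (n : ℕ) (r : ℝ)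
    (h : ∀ F : H →L[ℂ] H, LinearMap.rank (F : H →ₗ[ℂ] H) ≤ n → r ≤ ‖A - F‖) :
    r ≤ singularValue A n := by
  have : Nonempty {F : H →L[ℂ] H // LinearMap.rank (F : H →ₗ[ℂ] H) ≤ n} :=
    ⟨⟨0, by simp⟩⟩
  exact le_ciInf fun F => h F.1 F.2

theorem singularValue_smul_le (c : ℂ) (A : H →L[ℂ] H) (n : ℕ) :
    singularValue (c • A) n ≤ ‖c‖ * singularValue A n := by
  rcases eq_or_ne c 0 with rfl | hc
  · have := singularValue_le ((0 : ℂ) • A) 0 n (by simp)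
    simpa using this
  · rw [← div_le_iff₀' (norm_pos_iff.2 hc)]
    refine le_singularValue A n _ fun F hF => ?_
    rw [div_le_iff₀' (norm_pos_iff.2 hc), ← norm_smul, smul_sub]
    refine singularValue_le _ _ _ (le_trans ?_ hF)
    have : ((c • F : H →L[ℂ] H) : H →ₗ[ℂ] H) = (c • LinearMap.id) ∘ₗ (F : H →ₗ[ℂ] H) := by
      ext; simp
    rw [this]
    exact LinearMap.rank_comp_le_right _ _

theorem singularValue_smul (c : ℂ) (A : H →L[ℂ] H) (n : ℕ) :
    singularValue (c • A) n = ‖c‖ * singularValue A n := by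
  refine le_antisymm (singularValue_smul_le c A n) ?_
  rcases eq_or_ne c 0 with rfl | hc
  · simpa using singularValue_nonneg ((0 : ℂ) • A) n
  · have := singularValue_smul_le c⁻¹ (c • A) n
    rw [smul_smul, inv_mul_cancel₀ hc, one_smul, norm_inv] at this
    rwa [← le_inv_mul_iff₀ (norm_pos_iff.2 hc)]

/-- A nonzero compact operator attains its norm at a unit vector, which is an eigenvector
of `B* B` with eigenvalue `‖B‖ ^ 2`. -/
theorem exists_norm_attaining [CompleteSpace H] {B : H →L[ℂ] H} (hB : IsCompactOperator B) :
    ∃ u : H, (B = 0 → u = 0) ∧ (B ≠ 0 → ‖u‖ = 1) ∧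
      ∀ w, ⟪B u, B w⟫_ℂ = (‖B‖ ^ 2 : ℝ) * ⟪u, w⟫_ℂ := by
  rcases eq_or_ne B 0 with rfl | h0
  · exact ⟨0, by simp, by simp⟩
  have hpos : 0 < ‖B‖ := norm_pos_iff.2 h0
  have hseq : ∀ n : ℕ, ∃ x : H, ‖x‖ ≤ 1 ∧ ‖B‖ - 1 / ((n : ℝ) + 1) < ‖B x‖ := by
    intro n
    obtain ⟨x, hx, hx'⟩ := B.exists_lt_apply_of_lt_opNorm
      (r := ‖B‖ - 1 / ((n : ℝ) + 1)) (by
        have : (0 : ℝ) < 1 / ((n : ℝ) + 1) := by positivity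
        linarith)
    exact ⟨x, hx.le, hx'⟩
  choose x hx1 hx2 using hseq
  obtain ⟨K, hK, hKB⟩ := hB.image_closedBall_subset_compact (𝕜₁ := ℂ) (f := (B : H →ₗ[ℂ] H)) 1
  obtain ⟨y, -, φ, hφ, hy⟩ := hK.tendsto_subseq (x := fun n => B (x n))
    (fun n => hKB ⟨x n, by simpa using hx1 n, rfl⟩)
  have hlim : Tendsto (fun n : ℕ => ‖B‖ - 1 / ((n : ℝ) + 1)) atTop (𝓝 ‖B‖) := by
    simpa using (tendsto_const_nhds (x := ‖B‖)).sub tendsto_one_div_add_atTop_nhds_zero_nat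
  have hny : ‖y‖ = ‖B‖ := by
    refine tendsto_nhds_unique hy.norm
      (Tendsto.comp (g := fun n => ‖B (x n)‖) ?_ hφ.tendsto_atTop)
    refine tendsto_of_tendsto_of_tendsto_of_le_of_le hlim tendsto_const_nhds
      (fun n => (hx2 n).le) (fun n => ?_)
    exact (B.le_opNorm _).trans (mul_le_of_le_one_right (norm_nonneg _) (hx1 n))
  set z : H := ContinuousLinearMap.adjoint B y with hz
  have hzn : ‖z‖ ≤ ‖B‖ ^ 2 := by
    calc ‖z‖ ≤ ‖ContinuousLinearMap.adjoint B‖ * ‖y‖ := ContinuousLinearMap.le_opNorm _ _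
      _ = ‖B‖ ^ 2 := by rw [LinearIsometryEquiv.norm_map, hny, sq]
  -- the maximizing subsequence converges to a multiple of `B* y`
  have hconv : Tendsto (fun n => ((‖B‖ ^ 2 : ℝ) : ℂ) • x (φ n)) atTop (𝓝 z) := by
    rw [tendsto_iff_norm_sub_tendsto_zero]
    have hup : ∀ n, ‖((‖B‖ ^ 2 : ℝ) : ℂ) • x (φ n) - z‖ ^ 2
        ≤ 2 * ‖B‖ ^ 4 - 2 * ‖B‖ ^ 2 * RCLike.re ⟪B (x (φ n)), y⟫_ℂ := by
      intro n
      rw [@norm_sub_sq ℂ, inner_smul_left, hz, ContinuousLinearMap.adjoint_inner_right,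
        norm_smul]
      have e1 : ‖((‖B‖ ^ 2 : ℝ) : ℂ)‖ = ‖B‖ ^ 2 := by simp
      have e2 : RCLike.re ((starRingEnd ℂ) ((‖B‖ ^ 2 : ℝ) : ℂ) * ⟪B (x (φ n)), y⟫_ℂ)
          = ‖B‖ ^ 2 * RCLike.re ⟪B (x (φ n)), y⟫_ℂ := by
        rw [Complex.conj_ofReal]; exact Complex.re_ofReal_mul _ _
      rw [e1, e2, ← hz]
      have h1 : (‖B‖ ^ 2 * ‖x (φ n)‖) ^ 2 ≤ ‖B‖ ^ 4 := by
        have : ‖B‖ ^ 2 * ‖x (φ n)‖ ≤ ‖B‖ ^ 2 :=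
          mul_le_of_le_one_right (by positivity) (hx1 _)
        calc _ ≤ (‖B‖ ^ 2) ^ 2 := by gcongr
          _ = _ := by ring
      have h2 : ‖z‖ ^ 2 ≤ ‖B‖ ^ 4 := by
        calc _ ≤ (‖B‖ ^ 2) ^ 2 := by gcongr
          _ = _ := by ring
      linarith
    have hin : Tendsto (fun n => 2 * ‖B‖ ^ 4 - 2 * ‖B‖ ^ 2 * RCLike.re ⟪B (x (φ n)), y⟫_ℂ)
        atTop (𝓝 0) := by
      have h1 : Tendsto (fun n => RCLike.re ⟪B (x (φ n)), y⟫_ℂ) atTop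
          (𝓝 (RCLike.re ⟪y, y⟫_ℂ)) :=
        (RCLike.continuous_re.tendsto _).comp (hy.inner tendsto_const_nhds)
      have h2 := (tendsto_const_nhds (x := 2 * ‖B‖ ^ 4)).sub (h1.const_mul (2 * ‖B‖ ^ 2))
      have : 2 * ‖B‖ ^ 4 - 2 * ‖B‖ ^ 2 * RCLike.re ⟪y, y⟫_ℂ = 0 := by
        rw [inner_self_eq_norm_sq, hny]; ring
      rwa [this] at h2
    have hsq := squeeze_zero (fun n => sq_nonneg _) hup hin
    have := hsq.sqrt
    simpa [Real.sqrt_sq] using this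
  have hBz : B z = ((‖B‖ ^ 2 : ℝ) : ℂ) • y := by
    refine tendsto_nhds_unique ((B.continuous.tendsto _).comp hconv) ?_
    simpa only [Function.comp_def, map_smul] using hy.const_smul ((‖B‖ ^ 2 : ℝ) : ℂ)
  have hc : ((‖B‖ ^ 2 : ℝ) : ℂ) ≠ 0 := by
    exact_mod_cast (by positivity : (‖B‖ ^ 2 : ℝ) ≠ 0)
  set u : H := ((‖B‖ ^ 2 : ℝ) : ℂ)⁻¹ • z with hu
  have hBu : B u = y := by rw [hu, map_smul, hBz, smul_smul, inv_mul_cancel₀ hc, one_smul]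
  have hzu : z = ((‖B‖ ^ 2 : ℝ) : ℂ) • u := by
    rw [hu, smul_smul, mul_inv_cancel₀ hc, one_smul]
  refine ⟨u, fun h => absurd h h0, fun _ => ?_, ?_⟩
  · apply le_antisymm
    · rw [hu, norm_smul, norm_inv]
      have e1 : ‖((‖B‖ ^ 2 : ℝ) : ℂ)‖ = ‖B‖ ^ 2 := by simp
      rw [e1, inv_mul_le_iff₀ (by positivity)]; simpa using hzn
    · have := B.le_opNorm u
      rw [hBu, hny] at this
      exact (le_mul_iff_one_le_right hpos).1 this
  · intro w
    rw [hBu, ← ContinuousLinearMap.adjoint_inner_left, ← hz, hzu, inner_smul_left,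
      Complex.conj_ofReal]

theorem norm_sq_sum_smul {w : ℕ → H} (hw : ∀ m n, m ≠ n → ⟪w m, w n⟫_ℂ = 0)
    (c : ℕ → ℂ) (s : Finset ℕ) :
    ‖∑ i ∈ s, c i • w i‖ ^ 2 = ∑ i ∈ s, ‖c i‖ ^ 2 * ‖w i‖ ^ 2 := by
  classical
  induction s using Finset.induction_on with
  | empty => simp
  | insert a s ha ih =>
    rw [Finset.sum_insert ha, Finset.sum_insert ha, @norm_add_sq ℂ, ih, inner_sum]
    have : ∑ i ∈ s, ⟪c a • w a, c i • w i⟫_ℂ = 0 := by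
      refine Finset.sum_eq_zero fun i hi => ?_
      rw [inner_smul_left, inner_smul_right, hw a i (by rintro rfl; exact ha hi)]; simp
    rw [this, norm_smul]
    simp [mul_pow]

open InnerProductSpace in
theorem rank_sum_rankOne_le (a b : ℕ → H) (n : ℕ) :
    LinearMap.rank ((∑ k ∈ Finset.range n, rankOne ℂ (a k) (b k) : H →L[ℂ] H) : H →ₗ[ℂ] H)
      ≤ n := by
  induction n with
  | zero => simp
  | succ n ih =>
    rw [Finset.sum_range_succ]
    rw [ContinuousLinearMap.toLinearMap_add, Nat.cast_succ]
    refine (LinearMap.rank_add_le _ _).trans (add_le_add ih ?_)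
    have : LinearMap.range ((rankOne ℂ (a n) (b n) : H →L[ℂ] H) : H →ₗ[ℂ] H)
        ≤ Submodule.span ℂ {a n} := by
      rintro _ ⟨x, rfl⟩
      exact Submodule.mem_span_singleton.2 ⟨_, rfl⟩
    refine (Submodule.rank_mono this).trans ((rank_span_le _).trans ?_)
    simp

open InnerProductSpace in
/-- Singular value decomposition of a compact operator `A`: with `s n = singularValue A n`, which
decreases to `0`, there are orthogonal systems `u`, `v`, consisting of unit vectors where `s n ≠ 0`
(and `0` elsewhere), with `A (u n) = s n • v n` and `A = ∑ n, s n • ⟪u n, ·⟫ v n` in operator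
norm. -/
theorem exists_schmidt [CompleteSpace H] {A : H →L[ℂ] H} (hA : IsCompactOperator A) :
    ∃ u v : ℕ → H,
      (∀ m n, m ≠ n → ⟪u m, u n⟫_ℂ = 0) ∧ (∀ m n, m ≠ n → ⟪v m, v n⟫_ℂ = 0) ∧
      (∀ n, singularValue A n ≠ 0 → ‖u n‖ = 1 ∧ ‖v n‖ = 1) ∧
      (∀ n, singularValue A n = 0 → u n = 0 ∧ v n = 0) ∧
      (∀ n, A (u n) = (singularValue A n : ℂ) • v n) ∧
      Antitone (singularValue A) ∧ Tendsto (singularValue A) atTop (𝓝 0) ∧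
      ∀ n, ‖A - ∑ k ∈ Finset.range n, (singularValue A k : ℂ) • rankOne ℂ (v k) (u k)‖
        = singularValue A n := by
  have hpick : ∀ B : H →L[ℂ] H, ∃ u : H, IsCompactOperator B →
      ((B = 0 → u = 0) ∧ (B ≠ 0 → ‖u‖ = 1) ∧
        ∀ w, ⟪B u, B w⟫_ℂ = (‖B‖ ^ 2 : ℝ) * ⟪u, w⟫_ℂ) := by
    intro B
    by_cases hB : IsCompactOperator B
    · obtain ⟨u, hu⟩ := exists_norm_attaining hB
      exact ⟨u, fun _ => hu⟩
    · exact ⟨0, fun h => absurd h hB⟩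
  choose pick hpick using hpick
  let R : ℕ → (H →L[ℂ] H) := fun n =>
    Nat.rec A (fun _ B => B - rankOne ℂ (B (pick B)) (pick B)) n
  have hR0 : R 0 = A := rfl
  have hRs : ∀ n, R (n + 1) = R n - rankOne ℂ (R n (pick (R n))) (pick (R n)) := fun n => rfl
  have hRsx : ∀ n x, R (n + 1) x = R n (x - ⟪pick (R n), x⟫_ℂ • pick (R n)) := by
    intro n x; rw [hRs]; simp
  have hRc : ∀ n, IsCompactOperator (R n) := by
    intro n
    induction n with
    | zero => exact hA
    | succ n ih =>
      have : (R (n + 1) : H → H) = R n ∘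
          ((ContinuousLinearMap.id ℂ H - rankOne ℂ (pick (R n)) (pick (R n)) : H →L[ℂ] H)) := by
        funext x; rw [hRsx]; simp
      rw [this]
      exact ih.comp_clm _
  generalize hu : (fun n => pick (R n)) = u
  have hu' : ∀ n, pick (R n) = u n := fun n => congrFun hu n
  simp only [hu'] at hRs hRsx
  have hp0 : ∀ n, R n = 0 → u n = 0 := fun n => by
    rw [← hu']; exact (hpick _ (hRc n)).1
  have hp1 : ∀ n, R n ≠ 0 → ‖u n‖ = 1 := fun n => by
    rw [← hu']; exact (hpick _ (hRc n)).2.1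
  have hp2 : ∀ n w, ⟪R n (u n), R n w⟫_ℂ = (‖R n‖ ^ 2 : ℝ) * ⟪u n, w⟫_ℂ := fun n => by
    rw [← hu']; exact (hpick _ (hRc n)).2.2
  clear_value R
  clear hu hu' hpick pick
  -- the vectors already used are annihilated
  have hself : ∀ n, R (n + 1) (u n) = 0 := by
    intro n
    rw [hRsx]
    by_cases h : R n = 0
    · rw [h]; simp
    · rw [inner_self_eq_norm_sq_to_K, hp1 n h]; simp
  have hperp : ∀ n w, R n w = 0 → ⟪u n, w⟫_ℂ = 0 := by
    intro n w hw
    by_cases h : R n = 0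
    · rw [hp0 n h]; simp
    · have := hp2 n w
      rw [hw, inner_zero_right] at this
      have hc : ((‖R n‖ ^ 2 : ℝ) : ℂ) ≠ 0 := by
        have := norm_pos_iff.2 h
        exact_mod_cast (by positivity : (‖R n‖ ^ 2 : ℝ) ≠ 0)
      exact (mul_eq_zero.1 this.symm).resolve_left hc
  have hker : ∀ j d, R (j + 1 + d) (u j) = 0 := by
    intro j d
    induction d with
    | zero => exact hself j
    | succ d ih => rw [← add_assoc, hRsx, hperp _ _ ih]; simpa using ih
  have hker' : ∀ j n, j < n → R n (u j) = 0 := by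
    intro j n h
    obtain ⟨d, rfl⟩ := Nat.exists_eq_add_of_le (Nat.succ_le_of_lt h)
    exact hker j d
  have hou : ∀ m n, m ≠ n → ⟪u m, u n⟫_ℂ = 0 := by
    intro m n h
    rcases lt_or_gt_of_ne h with h | h
    · rw [← inner_conj_symm, hperp n _ (hker' m n h)]; simp
    · exact hperp m _ (hker' n m h)
  have hran : ∀ j d x, ⟪R j (u j), R (j + 1 + d) x⟫_ℂ = 0 := by
    intro j d
    induction d with
    | zero =>
      intro x
      rw [add_zero, hRsx, hp2, inner_sub_right, inner_smul_right]
      by_cases h : R j = 0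
      · rw [hp0 j h]; simp
      · rw [inner_self_eq_norm_sq_to_K, hp1 j h]; simp
    | succ d ih => intro x; rw [← add_assoc, hRsx]; exact ih _
  have hov : ∀ m n, m ≠ n → ⟪R m (u m), R n (u n)⟫_ℂ = 0 := by
    have : ∀ m n, m < n → ⟪R m (u m), R n (u n)⟫_ℂ = 0 := by
      intro m n h
      obtain ⟨d, rfl⟩ := Nat.exists_eq_add_of_le (Nat.succ_le_of_lt h)
      exact hran m d _
    intro m n h
    rcases lt_or_gt_of_ne h with h | h
    · exact this m n h
    · rw [← inner_conj_symm, this n m h]; simp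
  have hu1 : ∀ n, ‖u n‖ ≤ 1 := by
    intro n
    by_cases h : R n = 0
    · rw [hp0 n h]; simp
    · exact (hp1 n h).le
  have hRu : ∀ n, ‖R n (u n)‖ = ‖R n‖ := by
    intro n
    by_cases h : R n = 0
    · rw [h]; simp
    · have h1 := hp2 n (u n)
      rw [inner_self_eq_norm_sq_to_K, inner_self_eq_norm_sq_to_K, hp1 n h] at h1
      have h2 : ‖R n (u n)‖ ^ 2 = ‖R n‖ ^ 2 := by
        have : ((‖R n (u n)‖ ^ 2 : ℝ) : ℂ) = ((‖R n‖ ^ 2 : ℝ) : ℂ) := by simpa using h1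
        exact_mod_cast this
      exact (sq_eq_sq₀ (norm_nonneg _) (norm_nonneg _)).1 h2
  have hanti : Antitone fun n => ‖R n‖ := by
    refine antitone_nat_of_succ_le fun n => ?_
    refine ContinuousLinearMap.opNorm_le_bound _ (norm_nonneg _) fun x => ?_
    rw [hRsx]
    refine ((R n).le_opNorm _).trans (mul_le_mul_of_nonneg_left ?_ (norm_nonneg _))
    by_cases h : R n = 0
    · rw [hp0 n h]; simp
    · refine (sq_le_sq₀ (norm_nonneg _) (norm_nonneg _)).1 ?_
      rw [@norm_sub_sq ℂ, inner_smul_right, norm_smul, hp1 n h, inner_mul_symm_re_eq_norm,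
        norm_mul, norm_inner_symm x]
      nlinarith [sq_nonneg ‖⟪u n, x⟫_ℂ‖]
  have hsum : ∀ n, A - ∑ k ∈ Finset.range n, rankOne ℂ (R k (u k)) (u k) = R n := by
    intro n
    induction n with
    | zero => simp [hR0]
    | succ n ih => rw [Finset.sum_range_succ, ← sub_sub, ih, hRs]
  have hAu : ∀ n, A (u n) = R n (u n) := by
    intro n
    rw [← hsum n]
    have : (∑ k ∈ Finset.range n, rankOne ℂ (R k (u k)) (u k)) (u n) = 0 := by
      rw [sum_apply]
      refine Finset.sum_eq_zero fun k hk => ?_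
      rw [rankOne_apply, hou k n (Finset.mem_range.1 hk).ne]; simp
    rw [sub_apply, this, sub_zero]
  have hsv : ∀ n, singularValue A n = ‖R n‖ := by
    intro n
    apply le_antisymm
    · rw [← hsum n]
      exact singularValue_le _ _ _ (rank_sum_rankOne_le _ _ n)
    · refine le_singularValue _ _ _ fun F hF => ?_
      rcases (norm_nonneg (R n)).eq_or_lt with h | hpos
      · rw [← h]; exact norm_nonneg _
      have hun : ∀ k ≤ n, ‖u k‖ = 1 := fun k hk => hp1 k (norm_pos_iff.1
        (hpos.trans_le (hanti hk)))
      let E : (Fin (n + 1) → ℂ) →ₗ[ℂ] H :=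
        Fintype.linearCombination ℂ (fun i : Fin (n + 1) => u i)
      have hninj : ¬ Function.Injective ((F : H →ₗ[ℂ] H) ∘ₗ E) := by
        intro hinj
        have h1 := LinearMap.lift_rank_le_of_injective _ ((LinearMap.injective_rangeRestrict_iff _).2 hinj)
        have h2 := (LinearMap.rank_comp_le_left E (F : H →ₗ[ℂ] H)).trans hF
        unfold LinearMap.rank at h2
        rw [rank_fun'] at h1
        have h4 := h1.trans (Cardinal.lift_le.2 h2)
        rw [Fintype.card_fin, Cardinal.lift_natCast, Cardinal.lift_natCast, Nat.cast_le] at h4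
        omega
      rw [← LinearMap.ker_eq_bot, Submodule.eq_bot_iff] at hninj
      push Not at hninj
      obtain ⟨c, hc, hc0⟩ := hninj
      let c' : ℕ → ℂ := fun i => if h : i < n + 1 then c ⟨i, h⟩ else 0
      have hE : E c = ∑ i ∈ Finset.range (n + 1), c' i • u i := by
        rw [Finset.sum_range, Fintype.linearCombination_apply]
        refine Finset.sum_congr rfl fun i _ => ?_
        rw [show c' i = c i from dif_pos i.2]
      have hFx : F (E c) = 0 := by simpa using hc
      have hx : ‖E c‖ ^ 2 = ∑ i ∈ Finset.range (n + 1), ‖c' i‖ ^ 2 := by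
        rw [hE, norm_sq_sum_smul hou]
        refine Finset.sum_congr rfl fun i hi => ?_
        rw [hun i (by simpa [Nat.lt_succ_iff] using hi)]; simp
      have hAx : ‖A (E c)‖ ^ 2 = ∑ i ∈ Finset.range (n + 1), ‖c' i‖ ^ 2 * ‖R i‖ ^ 2 := by
        rw [hE, map_sum]
        simp only [map_smul, hAu]
        rw [norm_sq_sum_smul hov]
        simp only [hRu]
      have hxpos : 0 < ‖E c‖ := by
        have hne : ∃ i, c i ≠ 0 := by
          by_contra hcon; push Not at hcon; exact hc0 (funext hcon)
        obtain ⟨i, hi⟩ := hne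
        have h1 : 0 < ‖E c‖ ^ 2 := by
          rw [hx]
          refine Finset.sum_pos' (fun _ _ => sq_nonneg _) ⟨i, by simpa using i.2, ?_⟩
          have : c' i = c i := dif_pos i.2
          rw [this]
          exact pow_pos (norm_pos_iff.2 hi) 2
        exact (norm_nonneg _).lt_of_ne fun h => by rw [← h] at h1; simp at h1
      have hge : ‖R n‖ * ‖E c‖ ≤ ‖A (E c)‖ := by
        refine (sq_le_sq₀ (by positivity) (norm_nonneg _)).1 ?_
        rw [mul_pow, hx, hAx, Finset.mul_sum]
        refine Finset.sum_le_sum fun i hi => ?_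
        rw [mul_comm]
        have := hanti (show i ≤ n by simpa [Nat.lt_succ_iff] using hi)
        dsimp only at this
        gcongr
      have hle : ‖A (E c)‖ ≤ ‖A - F‖ * ‖E c‖ := by
        have := (A - F).le_opNorm (E c)
        simpa [hFx] using this
      exact le_of_mul_le_mul_right (hge.trans hle) hxpos
  have hlim : Tendsto (fun n => ‖R n‖) atTop (𝓝 0) := by
    obtain ⟨K, hK, hKA⟩ :=
      hA.image_closedBall_subset_compact (𝕜₁ := ℂ) (f := (A : H →ₗ[ℂ] H)) 1
    obtain ⟨y, -, φ, hφ, hy⟩ := hK.tendsto_subseq (x := fun n => A (u n))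
      (fun n => hKA ⟨u n, by simpa using hu1 n, rfl⟩)
    have hcau := hy.cauchySeq
    have hbdd : BddBelow (Set.range fun n => ‖R n‖) :=
      ⟨0, by rintro _ ⟨n, rfl⟩; exact norm_nonneg _⟩
    have h1 := tendsto_atTop_ciInf hanti hbdd
    set l := ⨅ n, ‖R n‖ with hl
    have hl0 : 0 ≤ l := Real.iInf_nonneg fun _ => norm_nonneg _
    rcases hl0.eq_or_lt with h | h
    · rwa [← h] at h1
    exfalso
    rw [Metric.cauchySeq_iff'] at hcau
    obtain ⟨N, hN⟩ := hcau l h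
    have h2 := hN (N + 1) (Nat.le_succ N)
    have hne : φ (N + 1) ≠ φ N := (hφ (Nat.lt_succ_self N)).ne'
    have h3 : l ≤ ‖R (φ (N + 1))‖ := ciInf_le hbdd _
    have h4 : ‖A (u (φ (N + 1))) - A (u (φ N))‖ ^ 2
        = ‖R (φ (N + 1))‖ ^ 2 + ‖R (φ N)‖ ^ 2 := by
      rw [hAu, hAu, @norm_sub_sq ℂ, hov _ _ hne, hRu, hRu]; simp
    simp only [Function.comp_apply, dist_eq_norm] at h2
    nlinarith [norm_nonneg (A (u (φ (N + 1))) - A (u (φ N))), sq_nonneg ‖R (φ N)‖]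
  have hsv' : singularValue A = fun n => ‖R n‖ := funext hsv
  refine ⟨u, fun n => ((‖R n‖ : ℝ) : ℂ)⁻¹ • R n (u n), hou, ?_, ?_, ?_, ?_, ?_, ?_, ?_⟩
  · intro m n h
    rw [inner_smul_left, inner_smul_right, hov m n h]; simp
  · intro n hn
    rw [hsv] at hn
    refine ⟨hp1 n (norm_ne_zero_iff.1 hn), ?_⟩
    rw [norm_smul, hRu]
    simp [hn]
  · intro n hn
    rw [hsv] at hn
    have := norm_eq_zero.1 hn
    exact ⟨hp0 n this, by simp [this]⟩
  · intro n
    rw [hAu, hsv, smul_smul]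
    by_cases h : ‖R n‖ = 0
    · have := norm_eq_zero.1 h
      simp [this]
    · have hc : ((‖R n‖ : ℝ) : ℂ) ≠ 0 := by exact_mod_cast h
      rw [mul_inv_cancel₀ hc, one_smul]
  · rw [hsv']; exact hanti
  · rw [hsv']; exact hlim
  · intro n
    have : ∀ k, (singularValue A k : ℂ) •
        rankOne ℂ (((‖R k‖ : ℝ) : ℂ)⁻¹ • R k (u k)) (u k) = rankOne ℂ (R k (u k)) (u k) := by
      intro k
      rw [hsv]
      by_cases h : ‖R k‖ = 0
      · have := norm_eq_zero.1 h
        simp [this]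
      · have hc : ((‖R k‖ : ℝ) : ℂ) ≠ 0 := by exact_mod_cast h
        rw [map_smul, smul_apply, smul_smul, mul_inv_cancel₀ hc, one_smul]
    simp only [this]
    rw [hsum, hsv]


theorem bessel {e : ℕ → H} (he : ∀ m n, m ≠ n → ⟪e m, e n⟫_ℂ = 0) (he1 : ∀ n, ‖e n‖ ≤ 1)
    (s : Finset ℕ) (x : H) : ∑ i ∈ s, ‖⟪e i, x⟫_ℂ‖ ^ 2 ≤ ‖x‖ ^ 2 := by
  have h1 : ‖∑ i ∈ s, ⟪e i, x⟫_ℂ • e i‖ ^ 2 ≤ ∑ i ∈ s, ‖⟪e i, x⟫_ℂ‖ ^ 2 := by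
    rw [norm_sq_sum_smul he]
    refine Finset.sum_le_sum fun i _ => mul_le_of_le_one_right (sq_nonneg _) ?_
    exact pow_le_one₀ (norm_nonneg _) (he1 i)
  have h2 : RCLike.re ⟪x, ∑ i ∈ s, ⟪e i, x⟫_ℂ • e i⟫_ℂ = ∑ i ∈ s, ‖⟪e i, x⟫_ℂ‖ ^ 2 := by
    rw [inner_sum, map_sum]
    refine Finset.sum_congr rfl fun i _ => ?_
    rw [inner_smul_right, inner_mul_symm_re_eq_norm, norm_mul, norm_inner_symm x, sq]
  have h3 := @norm_sub_sq ℂ _ _ _ _ x (∑ i ∈ s, ⟪e i, x⟫_ℂ • e i)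
  rw [h2] at h3
  nlinarith [sq_nonneg ‖x - ∑ i ∈ s, ⟪e i, x⟫_ℂ • e i‖]

theorem sum_mul_inner_le {e f : ℕ → H} (he : ∀ m n, m ≠ n → ⟪e m, e n⟫_ℂ = 0)
    (hf : ∀ m n, m ≠ n → ⟪f m, f n⟫_ℂ = 0) (he1 : ∀ n, ‖e n‖ ≤ 1) (hf1 : ∀ n, ‖f n‖ ≤ 1)
    (s : Finset ℕ) {x y : H} (hx : ‖x‖ ≤ 1) (hy : ‖y‖ ≤ 1) :
    ∑ i ∈ s, ‖⟪e i, x⟫_ℂ‖ * ‖⟪f i, y⟫_ℂ‖ ≤ 1 := by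
  have h1 := bessel he he1 s x
  have h2 := bessel hf hf1 s y
  have h3 : ∑ i ∈ s, ‖⟪e i, x⟫_ℂ‖ * ‖⟪f i, y⟫_ℂ‖
      ≤ ∑ i ∈ s, (‖⟪e i, x⟫_ℂ‖ ^ 2 + ‖⟪f i, y⟫_ℂ‖ ^ 2) / 2 :=
    Finset.sum_le_sum fun i _ => by
      nlinarith [sq_nonneg (‖⟪e i, x⟫_ℂ‖ - ‖⟪f i, y⟫_ℂ‖)]
  rw [← Finset.sum_div, Finset.sum_add_distrib] at h3
  have h4 : ‖x‖ ^ 2 ≤ 1 := pow_le_one₀ (norm_nonneg _) hx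
  have h5 : ‖y‖ ^ 2 ≤ 1 := pow_le_one₀ (norm_nonneg _) hy
  linarith

open InnerProductSpace in
/-- The diagonal of `A` in any two orthonormal systems is dominated by the singular values. -/
theorem sum_norm_inner_rpow_le [CompleteSpace H] {A : H →L[ℂ] H} (hA : IsCompactOperator A)
    {r : ℝ} (hr : 1 ≤ r) (hs : Summable fun n => singularValue A n ^ r)
    {e f : ℕ → H} (he : ∀ m n, m ≠ n → ⟪e m, e n⟫_ℂ = 0)
    (hf : ∀ m n, m ≠ n → ⟪f m, f n⟫_ℂ = 0) (he1 : ∀ n, ‖e n‖ ≤ 1) (hf1 : ∀ n, ‖f n‖ ≤ 1)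
    (I : Finset ℕ) :
    ∑ i ∈ I, ‖⟪f i, A (e i)⟫_ℂ‖ ^ r ≤ ∑' n, singularValue A n ^ r := by
  obtain ⟨u, v, hu, hv, hn1, hn0, -, -, hlim, hsum⟩ := exists_schmidt hA
  have hr0 : 0 < r := by linarith
  have hs0 := singularValue_nonneg A
  have hu1 : ∀ n, ‖u n‖ ≤ 1 := fun n => by
    by_cases h : singularValue A n = 0
    · rw [(hn0 n h).1]; simp
    · exact (hn1 n h).1.le
  have hv1 : ∀ n, ‖v n‖ ≤ 1 := fun n => by
    by_cases h : singularValue A n = 0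
    · rw [(hn0 n h).2]; simp
    · exact (hn1 n h).2.le
  set F : ℕ → (H →L[ℂ] H) := fun n =>
    ∑ k ∈ Finset.range n, (singularValue A k : ℂ) • rankOne ℂ (v k) (u k) with hF
  have hFA : Tendsto F atTop (𝓝 A) := by
    rw [tendsto_iff_norm_sub_tendsto_zero]
    refine hlim.congr fun n => ?_
    rw [norm_sub_rev, hF, hsum]
  have hbound : ∀ n, ∑ i ∈ I, ‖⟪f i, F n (e i)⟫_ℂ‖ ^ r ≤ ∑' n, singularValue A n ^ r := by
    intro n
    have hi : ∀ i, ‖⟪f i, F n (e i)⟫_ℂ‖ ^ r ≤ ∑ k ∈ Finset.range n,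
        (‖⟪e i, u k⟫_ℂ‖ * ‖⟪f i, v k⟫_ℂ‖) * singularValue A k ^ r := by
      intro i
      have h1 : ‖⟪f i, F n (e i)⟫_ℂ‖ ≤ ∑ k ∈ Finset.range n,
          (‖⟪e i, u k⟫_ℂ‖ * ‖⟪f i, v k⟫_ℂ‖) * singularValue A k := by
        rw [hF, sum_apply, inner_sum]
        refine (norm_sum_le _ _).trans (Finset.sum_le_sum fun k _ => ?_)
        rw [smul_apply, rankOne_apply, inner_smul_right, inner_smul_right, norm_mul, norm_mul,
          norm_inner_symm (u k)]
        simp only [Complex.norm_real, Real.norm_of_nonneg (hs0 k)]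
        exact le_of_eq (by ring)
      have h2 := Real.inner_le_weight_mul_Lp_of_nonneg (Finset.range n) hr
        (fun k => ‖⟪e i, u k⟫_ℂ‖ * ‖⟪f i, v k⟫_ℂ‖) (singularValue A)
        (fun k => by positivity) hs0
      have h3 : ∑ k ∈ Finset.range n, ‖⟪e i, u k⟫_ℂ‖ * ‖⟪f i, v k⟫_ℂ‖ ≤ 1 := by
        simp only [norm_inner_symm (e i), norm_inner_symm (f i)]
        exact sum_mul_inner_le hu hv hu1 hv1 _ (he1 i) (hf1 i)
      have h4 : (∑ k ∈ Finset.range n, ‖⟪e i, u k⟫_ℂ‖ * ‖⟪f i, v k⟫_ℂ‖) ^ (1 - r⁻¹) ≤ 1 :=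
        Real.rpow_le_one (Finset.sum_nonneg fun k _ => by positivity) h3
          (sub_nonneg.2 (inv_le_one_of_one_le₀ hr))
      have h5 : 0 ≤ ∑ k ∈ Finset.range n,
          (‖⟪e i, u k⟫_ℂ‖ * ‖⟪f i, v k⟫_ℂ‖) * singularValue A k ^ r :=
        Finset.sum_nonneg fun k _ => mul_nonneg (by positivity) (Real.rpow_nonneg (hs0 k) _)
      have h6 := (h1.trans h2).trans
        (mul_le_of_le_one_left (Real.rpow_nonneg h5 _) h4)
      have h7 := Real.rpow_le_rpow (norm_nonneg _) h6 hr0.le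
      rwa [Real.rpow_inv_rpow h5 hr0.ne'] at h7
    calc ∑ i ∈ I, ‖⟪f i, F n (e i)⟫_ℂ‖ ^ r
        ≤ ∑ i ∈ I, ∑ k ∈ Finset.range n,
          (‖⟪e i, u k⟫_ℂ‖ * ‖⟪f i, v k⟫_ℂ‖) * singularValue A k ^ r :=
          Finset.sum_le_sum fun i _ => hi i
      _ = ∑ k ∈ Finset.range n, (∑ i ∈ I, ‖⟪e i, u k⟫_ℂ‖ * ‖⟪f i, v k⟫_ℂ‖) *
          singularValue A k ^ r := by
          rw [Finset.sum_comm]; simp only [Finset.sum_mul]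
      _ ≤ ∑ k ∈ Finset.range n, singularValue A k ^ r :=
          Finset.sum_le_sum fun k _ => mul_le_of_le_one_left (Real.rpow_nonneg (hs0 k) _)
            (sum_mul_inner_le he hf he1 hf1 I (hu1 k) (hv1 k))
      _ ≤ ∑' n, singularValue A n ^ r :=
          hs.sum_le_tsum _ fun k _ => Real.rpow_nonneg (hs0 k) _
  suffices hT : Tendsto (fun n => ∑ i ∈ I, ‖⟪f i, F n (e i)⟫_ℂ‖ ^ r) atTop
      (𝓝 (∑ i ∈ I, ‖⟪f i, A (e i)⟫_ℂ‖ ^ r)) by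
    exact le_of_tendsto' hT hbound
  refine tendsto_finsetSum _ fun i _ => ?_
  refine Tendsto.rpow_const ?_ (Or.inr hr0.le)
  have h := ((ContinuousLinearMap.apply ℂ H (e i)).continuous.tendsto A).comp hFA
  exact (Tendsto.inner (tendsto_const_nhds (x := f i)) h).norm

theorem singularValue_le_norm (A : H →L[ℂ] H) (n : ℕ) : singularValue A n ≤ ‖A‖ := by
  simpa using singularValue_le A 0 n (by simp)

theorem singularValue_zero_right (A : H →L[ℂ] H) : singularValue A 0 = ‖A‖ := by
  refine le_antisymm (singularValue_le_norm A 0) (le_singularValue _ _ _ fun F hF => ?_)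
  have h : (F : H →ₗ[ℂ] H) = 0 := by
    apply LinearMap.range_eq_bot.1
    apply Submodule.rank_eq_zero.1
    simpa [LinearMap.rank] using hF
  have : F = 0 := by ext x; exact LinearMap.congr_fun h x
  rw [this, sub_zero]

theorem one_le_toReal {p : ℝ≥0∞} [hp : Fact (1 ≤ p)] (h : p ≠ ∞) : 1 ≤ p.toReal := by
  simpa using ENNReal.toReal_mono h hp.out

/-- The same in terms of the norm of `ℓ_p`, for `1 ≤ p ≤ ∞`. -/
theorem memℓp_inner [CompleteSpace H] {p : ℝ≥0∞} [Fact (1 ≤ p)] {A : H →L[ℂ] H}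
    (hA : IsCompactOperator A) (hs : Memℓp (singularValue A) p)
    {e f : ℕ → H} (he : ∀ m n, m ≠ n → ⟪e m, e n⟫_ℂ = 0)
    (hf : ∀ m n, m ≠ n → ⟪f m, f n⟫_ℂ = 0) (he1 : ∀ n, ‖e n‖ ≤ 1) (hf1 : ∀ n, ‖f n‖ ≤ 1) :
    ∃ h : Memℓp (fun n => ⟪f n, A (e n)⟫_ℂ) p,
      ‖(⟨_, h⟩ : lp (fun _ : ℕ => ℂ) p)‖ ≤ ‖(⟨_, hs⟩ : lp (fun _ : ℕ => ℝ) p)‖ := by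
  rcases eq_or_ne p ∞ with rfl | hp
  · have hb : ∀ n, ‖⟪f n, A (e n)⟫_ℂ‖ ≤ ‖A‖ := fun n => by
      calc _ ≤ ‖f n‖ * ‖A (e n)‖ := norm_inner_le_norm _ _
        _ ≤ 1 * (‖A‖ * 1) := by
          gcongr
          · exact hf1 n
          · exact (A.le_opNorm _).trans (by gcongr; exact he1 n)
        _ = ‖A‖ := by ring
    refine ⟨memℓp_infty ⟨‖A‖, by rintro _ ⟨n, rfl⟩; exact hb n⟩, ?_⟩
    refine lp.norm_le_of_forall_le (norm_nonneg _) fun n => (hb n).trans ?_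
    have := lp.norm_apply_le_norm (by simp) (⟨_, hs⟩ : lp (fun _ : ℕ => ℝ) ∞) 0
    refine le_trans ?_ this
    change ‖A‖ ≤ ‖singularValue A 0‖
    rw [singularValue_zero_right]; simp
  · have hr := one_le_toReal hp
    have hr0 : 0 < p.toReal := by linarith
    have hs0 := singularValue_nonneg A
    have hsm : Summable fun n => singularValue A n ^ p.toReal := by
      simpa [Real.norm_of_nonneg (hs0 _)] using hs.summable hr0
    have key := sum_norm_inner_rpow_le hA hr hsm he hf he1 hf1
    refine ⟨memℓp_gen' key, lp.norm_le_of_forall_sum_le hr0 (norm_nonneg _) fun I => ?_⟩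
    refine (key I).trans (le_of_eq ?_)
    rw [lp.norm_rpow_eq_tsum hr0]
    exact tsum_congr fun n => by
      change _ = ‖singularValue A n‖ ^ _
      rw [Real.norm_of_nonneg (hs0 _)]

/-- The triangle inequality for the Schatten norm. -/
theorem memℓp_singularValue_add [CompleteSpace H] {p : ℝ≥0∞} [Fact (1 ≤ p)] {A B : H →L[ℂ] H}
    (hA : IsCompactOperator A) (hB : IsCompactOperator B)
    (hAs : Memℓp (singularValue A) p) (hBs : Memℓp (singularValue B) p) :
    ∃ h : Memℓp (singularValue (A + B)) p,
      ‖(⟨_, h⟩ : lp (fun _ : ℕ => ℝ) p)‖ ≤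
        ‖(⟨_, hAs⟩ : lp (fun _ : ℕ => ℝ) p)‖ + ‖(⟨_, hBs⟩ : lp (fun _ : ℕ => ℝ) p)‖ := by
  have hC : IsCompactOperator (A + B : H →L[ℂ] H) := hA.add hB
  obtain ⟨u, v, hu, hv, hn1, hn0, hCu, -, -, -⟩ := exists_schmidt hC
  have hu1 : ∀ n, ‖u n‖ ≤ 1 := fun n => by
    by_cases h : singularValue (A + B) n = 0
    · rw [(hn0 n h).1]; simp
    · exact (hn1 n h).1.le
  have hv1 : ∀ n, ‖v n‖ ≤ 1 := fun n => by
    by_cases h : singularValue (A + B) n = 0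
    · rw [(hn0 n h).2]; simp
    · exact (hn1 n h).2.le
  have hval : ∀ n, ⟪v n, (A + B) (u n)⟫_ℂ = singularValue (A + B) n := by
    intro n
    rw [hCu, inner_smul_right]
    by_cases h : singularValue (A + B) n = 0
    · simp [h]
    · rw [inner_self_eq_norm_sq_to_K, (hn1 n h).2]; simp
  obtain ⟨ha, ha'⟩ := memℓp_inner hA hAs hu hv hu1 hv1
  obtain ⟨hb, hb'⟩ := memℓp_inner hB hBs hu hv hu1 hv1
  have hle : ∀ n, ‖singularValue (A + B) n‖ ≤
      ‖((⟨_, ha⟩ : lp (fun _ : ℕ => ℂ) p) + (⟨_, hb⟩ : lp (fun _ : ℕ => ℂ) p)) n‖ := by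
    intro n
    have h1 : ((⟨_, ha⟩ : lp (fun _ : ℕ => ℂ) p) + (⟨_, hb⟩ : lp (fun _ : ℕ => ℂ) p)) n
        = (singularValue (A + B) n : ℂ) := by
      rw [← hval, lp.coeFn_add, add_apply, inner_add_right]; rfl
    rw [h1, Complex.norm_real]
  refine ⟨(lp.memℓp ((⟨_, ha⟩ : lp (fun _ : ℕ => ℂ) p) + (⟨_, hb⟩))).mono' hle, ?_⟩
  calc _ ≤ ‖(⟨_, ha⟩ : lp (fun _ : ℕ => ℂ) p) + (⟨_, hb⟩ : lp (fun _ : ℕ => ℂ) p)‖ :=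
        lp.norm_mono (by have := Fact.out (p := 1 ≤ p); positivity) hle
    _ ≤ _ := (norm_add_le _ _).trans (add_le_add ha' hb')

variable {p : ℝ≥0∞} [Fact (1 ≤ p)] [CompleteSpace H]

/-- The compact operators on `H` whose sequence of singular values belongs to `ℓ_p`. -/
def schattenSubmodule (p : ℝ≥0∞) [Fact (1 ≤ p)]
    (H : Type*) [NormedAddCommGroup H] [InnerProductSpace ℂ H] [CompleteSpace H] :
    Submodule ℂ (H →L[ℂ] H) where
  carrier := {A | IsCompactOperator A ∧ Memℓp (singularValue A) p}
  add_mem' hA hB := ⟨hA.1.add hB.1, (memℓp_singularValue_add hA.1 hB.1 hA.2 hB.2).1⟩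
  zero_mem' := ⟨isCompactOperator_zero, by
    have : singularValue (0 : H →L[ℂ] H) = fun _ => 0 := funext fun n =>
      le_antisymm (by simpa using singularValue_le_norm (0 : H →L[ℂ] H) n)
        (singularValue_nonneg _ _)
    rw [this]; exact zero_mem_ℓp'⟩
  smul_mem' c A hA := ⟨hA.1.smul c, by
    have : singularValue (c • A) = ‖c‖ • singularValue A := funext fun n => by
      simp [singularValue_smul]
    rw [this]; exact hA.2.const_smul _⟩

/-- The Schatten space `S_p(H)`, a type of its own because its norm is not the operator norm:
`‖A‖ = ‖(s_i(A))_i‖_{ℓ_p}`. For `p = ∞` it is the space of compact operators. -/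
def SchattenClass (p : ℝ≥0∞) [Fact (1 ≤ p)]
    (H : Type*) [NormedAddCommGroup H] [InnerProductSpace ℂ H] [CompleteSpace H] : Type _ := ↥(schattenSubmodule p H)

instance : AddCommGroup (SchattenClass p H) :=
  inferInstanceAs (AddCommGroup (schattenSubmodule p H))

instance : Module ℂ (SchattenClass p H) := inferInstanceAs (Module ℂ (schattenSubmodule p H))

/-- An element of `S_p(H)`, viewed as a bounded operator on `H`. -/
def SchattenClass.toOperator : SchattenClass p H →ₗ[ℂ] (H →L[ℂ] H) :=
  (schattenSubmodule p H).subtype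

/-- The sequence of singular values of an element of `S_p(H)`, as an element of `ℓ_p`. -/
def SchattenClass.singularSeq (A : SchattenClass p H) : lp (fun _ : ℕ => ℝ) p :=
  ⟨singularValue A.toOperator, A.2.2⟩

instance : Norm (SchattenClass p H) := ⟨fun A => ‖A.singularSeq‖⟩

theorem SchattenClass.norm_def (A : SchattenClass p H) : ‖A‖ = ‖A.singularSeq‖ := rfl

theorem normedSpaceCore : NormedSpace.Core ℂ (SchattenClass p H) where
  norm_nonneg A := norm_nonneg A.singularSeq
  norm_smul c A := by
    have : (c • A).singularSeq = ‖c‖ • A.singularSeq := by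
      ext n
      exact singularValue_smul c A.toOperator n
    have hp : p ≠ 0 := (zero_lt_one.trans_le (Fact.out (p := 1 ≤ p))).ne'
    rw [SchattenClass.norm_def, this, lp.norm_const_smul hp, norm_norm,
      SchattenClass.norm_def]
  norm_triangle A B := (memℓp_singularValue_add A.2.1 B.2.1 A.2.2 B.2.2).2
  norm_eq_zero_iff A := by
    constructor
    · intro h
      have h1 : A.singularSeq = 0 := norm_eq_zero.1 h
      have h2 : singularValue A.toOperator 0 = 0 := by
        change A.singularSeq 0 = 0
        rw [h1]; rfl
      rw [singularValue_zero_right, norm_eq_zero] at h2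
      exact Subtype.ext h2
    · rintro rfl
      have : (0 : SchattenClass p H).singularSeq = 0 := by
        ext n
        refine le_antisymm ?_ (singularValue_nonneg _ _)
        refine (singularValue_le_norm _ _).trans (le_of_eq ?_)
        simp
      rw [SchattenClass.norm_def, this, norm_zero]

instance : NormedAddCommGroup (SchattenClass p H) := NormedAddCommGroup.ofCore normedSpaceCore

instance : NormedSpace ℂ (SchattenClass p H) := NormedSpace.ofCore normedSpaceCore

/-- `T` is positive: it maps the cone of positive operators in `S_p(H)` into itself. -/
def IsPositiveMap (T : SchattenClass p H →L[ℂ] SchattenClass p H) : Prop :=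
  ∀ A : SchattenClass p H, A.toOperator.IsPositive → (T A).toOperator.IsPositive

section Operators

variable {X Y : Type*} [NormedAddCommGroup X] [NormedSpace ℂ X]
  [NormedAddCommGroup Y] [NormedSpace ℂ Y]

/-- The restriction of `T` to the subspace `E` is an isomorphism (linear homeomorphism) from `E`
onto its image `T(E)`. -/
def IsIsomorphismOn (T : X →L[ℂ] Y) (E : Submodule ℂ X) : Prop :=
  ∃ e : E ≃L[ℂ] E.map (T : X →ₗ[ℂ] Y), ∀ x : E, (e x : Y) = T x

/-- `T` is strictly singular: it is not an isomorphism on any (closed) infinite-dimensional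
subspace. -/
def IsStrictlySingular (T : X →L[ℂ] Y) : Prop :=
  ∀ E : Submodule ℂ X, IsClosed (E : Set X) → ¬ FiniteDimensional ℂ E → ¬ IsIsomorphismOn T E

/-- `T` preserves a copy `E` of `ℓ_p` such that `E` and `T(E)` are both complemented (that is,
ranges of bounded projections). -/
def PreservesComplementedCopy (p : ℝ≥0∞) [Fact (1 ≤ p)] (T : X →L[ℂ] Y) : Prop :=
  ∃ E : Submodule ℂ X, Nonempty (E ≃L[ℂ] lp (fun _ : ℕ => ℂ) p) ∧ IsIsomorphismOn T E ∧
    E.ClosedComplemented ∧ (E.map (T : X →ₗ[ℂ] Y)).ClosedComplemented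

end Operators

end Schatten

end

noncomputable section

namespace Schatten

open scoped InnerProductSpace ComplexOrder
open Filter Topology

/-! Compactness implies strict singularity by the Riesz lemma, and a strictly singular map preserves
no copy of `ℓ_p` because `ℓ_p` is infinite-dimensional. The content is that a positive `T` which is
not compact preserves a complemented copy of `ℓ_p`.

For a finite set `S` of vectors let `P` be the orthogonal projection onto its span and `Q = 1 - P`;
the head of `X` is `PXP` and its tail is `QXQ`. For positive `A` the diagonal blocks control the
off-diagonal ones: `A` is close to its head when its tail is small (`norm_sub_head_le`), and `A ≤
2(PAP + QAQ)` (`isPositive_two_smul_head_add_tail_sub`). By the former, `T` is a norm limit of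
compact operators once its values on the positive part of the unit ball have uniformly small tails,
since four positive elements suffice to write any element. By the latter, head parts of the argument
may be discarded: `T` composed with a head is compact. So for noncompact `T` there is a fixed `δ`
such that arbitrarily far out, and almost in the kernel of any finite family of functionals, there
are elements of norm at most `2` whose images have tails of norm at least `δ`
(`exists_le_norm_tail_of_not_isCompactOperator`).

A gliding hump now gives finite-rank operators and functionals, mutually orthogonal on both sides,
with each functional equal to `1` on the image of its own operator and tiny on the images of the
others (`exists_block_sequence`). Two inequalities bring in `ℓ_p`: diagonal operators along
orthogonal systems have norm at most the `ℓ_p` norm of their coefficients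
(`norm_sum_smul_rankOne_le`), and the diagonal of `X` in two orthogonal systems has `ℓ_p` norm at
most `‖X‖` (`sum_norm_inner_rpow_le`). They yield bounded maps `J : ℓ_p → S_p` and `L : S_p → ℓ_p`
for which `L T J` is within `1/2` of the identity. Thus the identity of `ℓ_p` factors through `T`,
and the range of `J` is the required copy. -/

/-- A family of pairwise orthogonal vectors of norm at most one. -/
structure IsOrthoSystem {H : Type*} [NormedAddCommGroup H] [InnerProductSpace ℂ H] {ι : Type*}
    (e : ι → H) : Prop where
  inner_eq_zero : ∀ i j, i ≠ j → ⟪e i, e j⟫_ℂ = 0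
  norm_le_one : ∀ i, ‖e i‖ ≤ 1

/-! ### Orthogonal systems. -/

namespace IsOrthoSystem

variable {H : Type*} [NormedAddCommGroup H] [InnerProductSpace ℂ H] {ι κ : Type*} {e : ι → H}

theorem comp (he : IsOrthoSystem e) {g : κ → ι} (hg : Function.Injective g) :
    IsOrthoSystem (e ∘ g) :=
  ⟨fun _ _ h => he.1 _ _ (hg.ne h), fun _ => he.2 _⟩

/-- Zero vectors are admitted in a system, so padding is harmless. This carries inequalities for
systems indexed by `ℕ` over to finite index types. -/
theorem extend_zero (he : IsOrthoSystem e) {g : ι → κ} (hg : Function.Injective g) :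
    IsOrthoSystem (Function.extend g e 0) := by
  constructor
  · intro i j hij
    by_cases hi : ∃ a, g a = i
    · by_cases hj : ∃ b, g b = j
      · obtain ⟨a, rfl⟩ := hi
        obtain ⟨b, rfl⟩ := hj
        rw [hg.extend_apply, hg.extend_apply]
        exact he.1 _ _ (by rintro rfl; exact hij rfl)
      · rw [Function.extend_apply' _ _ j hj]; simp
    · rw [Function.extend_apply' _ _ i hi]; simp
  · intro i
    by_cases hi : ∃ a, g a = i
    · obtain ⟨a, rfl⟩ := hi
      rw [hg.extend_apply]; exact he.2 a
    · rw [Function.extend_apply' _ _ i hi]; simp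

theorem sum_mul_inner_le [Fintype ι] {f : ι → H} (he : IsOrthoSystem e) (hf : IsOrthoSystem f)
    {x y : H} (hx : ‖x‖ ≤ 1) (hy : ‖y‖ ≤ 1) :
    ∑ i, ‖⟪e i, x⟫_ℂ‖ * ‖⟪f i, y⟫_ℂ‖ ≤ 1 := by
  obtain ⟨g, hg⟩ := exists_injective_nat ι
  have he' := he.extend_zero hg
  have hf' := hf.extend_zero hg
  have := Schatten.sum_mul_inner_le he'.1 hf'.1 he'.2 hf'.2 (Finset.univ.map ⟨g, hg⟩) hx hy
  simpa [hg.extend_apply] using this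

end IsOrthoSystem

/-! ### Schatten norms through matrix coefficients, and completeness. -/

namespace SchattenClass

variable {H : Type*} [NormedAddCommGroup H] [InnerProductSpace ℂ H] [CompleteSpace H]
variable {p : ℝ≥0∞} [Fact (1 ≤ p)]

/-- A compact operator with `p`-summable singular values, as an element of `S_p(H)`. -/
def ofMem {A : H →L[ℂ] H} (hA : IsCompactOperator A) (hs : Memℓp (singularValue A) p) :
    SchattenClass p H := (⟨A, hA, hs⟩ : schattenSubmodule p H)

theorem isCompactOperator (A : SchattenClass p H) : IsCompactOperator A.toOperator := A.2.1

theorem toOperator_injective :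
    Function.Injective (toOperator : SchattenClass p H →ₗ[ℂ] (H →L[ℂ] H)) :=
  Subtype.val_injective

theorem toReal_pos_of_ne_top (hp : p ≠ ∞) : 0 < p.toReal :=
  zero_lt_one.trans_le (one_le_toReal hp)

theorem summable_singularValue (hp : p ≠ ∞) (A : SchattenClass p H) :
    Summable fun n => singularValue A.toOperator n ^ p.toReal := by
  have := A.singularSeq.2.summable (toReal_pos_of_ne_top hp)
  refine this.congr fun n => ?_
  change ‖singularValue A.toOperator n‖ ^ _ = _
  rw [Real.norm_of_nonneg (singularValue_nonneg _ _)]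

theorem norm_rpow_eq_tsum (hp : p ≠ ∞) (A : SchattenClass p H) :
    ‖A‖ ^ p.toReal = ∑' n, singularValue A.toOperator n ^ p.toReal := by
  rw [norm_def, lp.norm_rpow_eq_tsum (toReal_pos_of_ne_top hp)]
  refine tsum_congr fun n => ?_
  change ‖singularValue A.toOperator n‖ ^ _ = _
  rw [Real.norm_of_nonneg (singularValue_nonneg _ _)]

theorem norm_toOperator_le (A : SchattenClass p H) : ‖A.toOperator‖ ≤ ‖A‖ := by
  have hp : p ≠ 0 := (zero_lt_one.trans_le (Fact.out (p := 1 ≤ p))).ne'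
  have := lp.norm_apply_le_norm hp A.singularSeq 0
  change ‖singularValue A.toOperator 0‖ ≤ ‖A‖ at this
  rwa [singularValue_zero_right, norm_norm] at this

/-- The inclusion of `S_p(H)` into the bounded operators. -/
def toOperatorL : SchattenClass p H →L[ℂ] (H →L[ℂ] H) :=
  toOperator.mkContinuous 1 fun A => by simpa using norm_toOperator_le A

@[simp] theorem toOperatorL_apply (A : SchattenClass p H) : toOperatorL A = A.toOperator := rfl

/-- The diagonal of `A` in two orthogonal systems is dominated by the norm of `A`. -/
theorem sum_norm_inner_rpow_le (hp : p ≠ ∞) (A : SchattenClass p H) {ι : Type*} [Fintype ι]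
    {e f : ι → H} (he : IsOrthoSystem e) (hf : IsOrthoSystem f) :
    ∑ i, ‖⟪f i, A.toOperator (e i)⟫_ℂ‖ ^ p.toReal ≤ ‖A‖ ^ p.toReal := by
  obtain ⟨g, hg⟩ := exists_injective_nat ι
  have he' := he.extend_zero hg
  have hf' := hf.extend_zero hg
  have := Schatten.sum_norm_inner_rpow_le A.isCompactOperator (one_le_toReal hp)
    (A.summable_singularValue hp) he'.1 hf'.1 he'.2 hf'.2 (Finset.univ.map ⟨g, hg⟩)
  rw [norm_rpow_eq_tsum hp]
  simpa [hg.extend_apply] using this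

/-- The singular vectors of a compact operator form orthogonal systems. -/
theorem exists_schmidt_system {A : H →L[ℂ] H} (hA : IsCompactOperator A) :
    ∃ u v : ℕ → H, IsOrthoSystem u ∧ IsOrthoSystem v ∧
      (∀ n, A (u n) = (singularValue A n : ℂ) • v n) ∧
      (∀ n, ⟪v n, A (u n)⟫_ℂ = singularValue A n) ∧
      (∀ n, singularValue A n = 0 → u n = 0 ∧ v n = 0) ∧
      Antitone (singularValue A) ∧ Tendsto (singularValue A) atTop (𝓝 0) ∧
      ∀ n, ‖A - ∑ k ∈ Finset.range n,
        (singularValue A k : ℂ) • InnerProductSpace.rankOne ℂ (v k) (u k)‖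
        = singularValue A n := by
  obtain ⟨u, v, hu, hv, hn1, hn0, hAu, hanti, hlim, hsum⟩ := exists_schmidt hA
  refine ⟨u, v, ⟨hu, fun n => ?_⟩, ⟨hv, fun n => ?_⟩, hAu, fun n => ?_, hn0, hanti, hlim, hsum⟩
  · by_cases h : singularValue A n = 0
    · rw [(hn0 n h).1]; simp
    · exact (hn1 n h).1.le
  · by_cases h : singularValue A n = 0
    · rw [(hn0 n h).2]; simp
    · exact (hn1 n h).2.le
  · rw [hAu, inner_smul_right]
    by_cases h : singularValue A n = 0
    · simp [h]
    · rw [inner_self_eq_norm_sq_to_K, (hn1 n h).2]; simp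

/-- A compact operator whose diagonals in all pairs of orthogonal systems are bounded in `ℓ_p`
by `M` belongs to `S_p` with norm at most `M`. -/
theorem exists_eq_of_forall_sum_le (hp : p ≠ ∞) {X : H →L[ℂ] H} (hX : IsCompactOperator X)
    {M : ℝ} (hM : 0 ≤ M)
    (h : ∀ (n : ℕ) (e f : Fin n → H), IsOrthoSystem e → IsOrthoSystem f →
      ∑ i, ‖⟪f i, X (e i)⟫_ℂ‖ ^ p.toReal ≤ M ^ p.toReal) :
    ∃ Y : SchattenClass p H, Y.toOperator = X ∧ ‖Y‖ ≤ M := by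
  have hr := toReal_pos_of_ne_top hp
  -- Tested on the singular vectors of `X` itself, the hypothesis bounds the partial sums of the
  -- powers of the singular values.
  obtain ⟨u, v, hu, hv, -, hs, -⟩ := exists_schmidt_system hX
  have hb : ∀ n, ∑ i ∈ Finset.range n, singularValue X i ^ p.toReal ≤ M ^ p.toReal := by
    intro n
    have := h n _ _ (hu.comp Fin.val_injective) (hv.comp Fin.val_injective)
    rw [Finset.sum_range]
    refine le_trans (le_of_eq ?_) this
    refine Finset.sum_congr rfl fun i _ => ?_
    simp only [Function.comp_apply, hs, Complex.norm_real]
    rw [Real.norm_of_nonneg (singularValue_nonneg _ _)]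
  have h0 : ∀ n, 0 ≤ singularValue X n ^ p.toReal := fun n =>
    Real.rpow_nonneg (singularValue_nonneg _ _) _
  have hsum : Summable fun n => singularValue X n ^ p.toReal :=
    summable_of_sum_range_le h0 hb
  have hmem : Memℓp (singularValue X) p := by
    refine memℓp_gen ?_
    simpa [Real.norm_of_nonneg (singularValue_nonneg _ _)] using hsum
  refine ⟨ofMem hX hmem, rfl, ?_⟩
  rw [← Real.rpow_le_rpow_iff (norm_nonneg _) hM hr, norm_rpow_eq_tsum hp]
  exact Real.tsum_le_of_sum_range_le h0 hb

theorem norm_le_of_forall_sum_le (hp : p ≠ ∞) (X : SchattenClass p H)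
    {M : ℝ} (hM : 0 ≤ M)
    (h : ∀ (n : ℕ) (e f : Fin n → H), IsOrthoSystem e → IsOrthoSystem f →
      ∑ i, ‖⟪f i, X.toOperator (e i)⟫_ℂ‖ ^ p.toReal ≤ M ^ p.toReal) : ‖X‖ ≤ M := by
  obtain ⟨Y, hY, hYM⟩ := exists_eq_of_forall_sum_le hp X.isCompactOperator hM h
  rwa [← toOperator_injective hY]

/-- Comparison of Schatten norms through matrix coefficients. -/
theorem norm_le_of_forall_inner_le (hp : p ≠ ∞) (X Y Z : SchattenClass p H) {a b : ℝ}
    (ha : 0 ≤ a) (hb : 0 ≤ b)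
    (h : ∀ e f : H, ‖⟪f, X.toOperator e⟫_ℂ‖ ≤
      a * ‖⟪f, Y.toOperator f⟫_ℂ‖ + b * ‖⟪e, Z.toOperator e⟫_ℂ‖) :
    ‖X‖ ≤ a * ‖Y‖ + b * ‖Z‖ := by
  have hr := toReal_pos_of_ne_top hp
  refine norm_le_of_forall_sum_le hp X (by positivity) fun n e f he hf => ?_
  -- Only the diagonals of `Y` along `f` and of `Z` along `e` enter. Each is bounded in `ℓ_p` by the
  -- corresponding Schatten norm, and Minkowski's inequality adds them.
  have hcoef : ∀ (A : SchattenClass p H) (c : ℝ), 0 ≤ c → ∀ g : Fin n → H, IsOrthoSystem g →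
      (∑ i, (c * ‖⟪g i, A.toOperator (g i)⟫_ℂ‖) ^ p.toReal) ^ (1 / p.toReal) ≤ c * ‖A‖ := by
    intro A c hc g hg
    have h1 : ∑ i, (c * ‖⟪g i, A.toOperator (g i)⟫_ℂ‖) ^ p.toReal ≤ (c * ‖A‖) ^ p.toReal := by
      simp only [Real.mul_rpow hc (norm_nonneg _)]
      rw [← Finset.mul_sum]
      exact mul_le_mul_of_nonneg_left (A.sum_norm_inner_rpow_le hp hg hg) (by positivity)
    have h2 := Real.rpow_le_rpow (Finset.sum_nonneg fun i _ => by positivity) h1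
      (by positivity : 0 ≤ 1 / p.toReal)
    rwa [one_div, Real.rpow_rpow_inv (by positivity) hr.ne', ← one_div] at h2
  have hmink := Real.Lp_add_le_of_nonneg (s := Finset.univ)
    (f := fun i => a * ‖⟪f i, Y.toOperator (f i)⟫_ℂ‖)
    (g := fun i => b * ‖⟪e i, Z.toOperator (e i)⟫_ℂ‖) (one_le_toReal hp)
    (fun i _ => by positivity) (fun i _ => by positivity)
  have h3 := hmink.trans (add_le_add (hcoef Y a ha f hf) (hcoef Z b hb e he))
  have h4 := Real.rpow_le_rpow (by positivity) h3 hr.le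
  rw [one_div, Real.rpow_inv_rpow (by positivity) hr.ne'] at h4
  refine le_trans (Finset.sum_le_sum fun i _ => ?_) h4
  exact Real.rpow_le_rpow (norm_nonneg _) (h _ _) hr.le

/-- The Schatten norm dominates the operator norm, so a Cauchy sequence has a compact limit `B` in
operator norm. Finite diagonals pass to this limit, so the bound on `A n - A N` is inherited by `B -
A N`; this gives both membership of `B` and convergence. -/
theorem completeSpace (hp : p ≠ ∞) : CompleteSpace (SchattenClass p H) := by
  have hr := toReal_pos_of_ne_top hp
  refine Metric.complete_of_cauchySeq_tendsto fun A hA => ?_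
  have hA' : CauchySeq fun n => (A n).toOperator :=
    hA.map (toOperatorL (p := p) (H := H)).uniformContinuous
  obtain ⟨B, hB⟩ := cauchySeq_tendsto_of_complete hA'
  have hBc : IsCompactOperator B :=
    isCompactOperator_of_tendsto hB (Eventually.of_forall fun n => (A n).isCompactOperator)
  have key : ∀ (N : ℕ) (δ : ℝ), 0 ≤ δ → (∀ n ≥ N, ‖A n - A N‖ ≤ δ) →
      ∃ Y : SchattenClass p H, Y.toOperator = B - (A N).toOperator ∧ ‖Y‖ ≤ δ := by
    intro N δ hδ hN
    refine exists_eq_of_forall_sum_le hp (hBc.sub (A N).isCompactOperator) hδ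
      fun n e f he hf => ?_
    have hlim : Tendsto (fun m => ∑ i, ‖⟪f i, (A m - A N).toOperator (e i)⟫_ℂ‖ ^ p.toReal) atTop
        (𝓝 (∑ i, ‖⟪f i, (B - (A N).toOperator) (e i)⟫_ℂ‖ ^ p.toReal)) := by
      refine tendsto_finsetSum _ fun i _ => Tendsto.rpow_const ?_ (Or.inr hr.le)
      have h1 := ((ContinuousLinearMap.apply ℂ H (e i)).continuous.tendsto _).comp
        (hB.sub_const (A N).toOperator)
      refine (Tendsto.inner (tendsto_const_nhds (x := f i)) h1).norm.congr fun m => ?_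
      simp [inner_sub_right]
    refine le_of_tendsto hlim ?_
    filter_upwards [eventually_ge_atTop N] with m hm
    exact ((A m - A N).sum_norm_inner_rpow_le hp he hf).trans
      (Real.rpow_le_rpow (norm_nonneg _) (hN m hm) hr.le)
  rw [Metric.cauchySeq_iff'] at hA
  simp only [dist_eq_norm] at hA
  obtain ⟨N, hN⟩ := hA 1 one_pos
  obtain ⟨Y, hY, -⟩ := key N 1 zero_le_one fun n hn => (hN n hn).le
  refine ⟨Y + A N, ?_⟩
  have hYB : (Y + A N).toOperator = B := by rw [map_add, hY, sub_add_cancel]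
  rw [Metric.tendsto_atTop]
  intro ε hε
  obtain ⟨M, hM⟩ := hA (ε / 3) (by positivity)
  refine ⟨M, fun n hn => ?_⟩
  obtain ⟨Z, hZ, hZM⟩ := key M (ε / 3) (by positivity) fun n hn => (hM n hn).le
  have hZ' : Z = Y + A N - A M := toOperator_injective (by rw [hZ, map_sub, hYB])
  rw [dist_eq_norm]
  calc ‖A n - (Y + A N)‖ = ‖(A n - A M) - Z‖ := by rw [hZ']; congr 1; abel
    _ ≤ ‖A n - A M‖ + ‖Z‖ := norm_sub_le _ _
    _ ≤ ε / 3 + ε / 3 := add_le_add (hM n hn).le hZM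
    _ < ε := by linarith

end SchattenClass

/-! ### Maps out of `ℓ_p`, diagonal operators and two-sided multiplication. -/

/-- A sequence in a Banach space with an upper `ℓ_p` estimate is the image of the unit vectors
under a bounded operator on `ℓ_p`. -/
theorem exists_lp_map {p : ℝ≥0∞} [Fact (1 ≤ p)] (hp : p ≠ ∞) {X : Type*} [NormedAddCommGroup X]
    [NormedSpace ℂ X] [CompleteSpace X] (x : ℕ → X) {K : ℝ} (hK : 0 ≤ K)
    (h : ∀ (s : Finset ℕ) (c : ℕ → ℂ) (M : ℝ), 0 ≤ M → ∑ i ∈ s, ‖c i‖ ^ p.toReal ≤ M ^ p.toReal →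
      ‖∑ i ∈ s, c i • x i‖ ≤ K * M) :
    ∃ J : lp (fun _ : ℕ => ℂ) p →L[ℂ] X,
      (∀ a, HasSum (fun i => a i • x i) (J a)) ∧ ∀ a, ‖J a‖ ≤ K * ‖a‖ := by
  have hr : 0 < p.toReal := zero_lt_one.trans_le (one_le_toReal hp)
  have hsum : ∀ a : lp (fun _ : ℕ => ℂ) p, Summable fun i => a i • x i := by
    intro a
    rw [summable_iff_vanishing_norm]
    intro ε hε
    have hδ : 0 < ε / (K + 1) := by positivity
    obtain ⟨s, hs⟩ := summable_iff_vanishing_norm.1 ((lp.memℓp a).summable hr)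
      ((ε / (K + 1)) ^ p.toReal) (by positivity)
    refine ⟨s, fun t ht => ?_⟩
    have h1 := hs t ht
    rw [Real.norm_of_nonneg (Finset.sum_nonneg fun i _ => by positivity)] at h1
    refine (h t a _ hδ.le h1.le).trans_lt ?_
    rw [mul_div_assoc', div_lt_iff₀ (by positivity)]
    nlinarith
  have hnorm : ∀ a : lp (fun _ : ℕ => ℂ) p, ‖∑' i, a i • x i‖ ≤ K * ‖a‖ := by
    intro a
    refine le_of_tendsto (hsum a).hasSum.norm (Eventually.of_forall fun s => ?_)
    exact h s a _ (norm_nonneg _) (lp.sum_rpow_le_norm_rpow hr a s)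
  refine ⟨LinearMap.mkContinuous
    { toFun := fun a => ∑' i, a i • x i
      map_add' := fun a b => ?_
      map_smul' := fun c a => ?_ } K hnorm, fun a => (hsum a).hasSum, hnorm⟩
  · rw [← (hsum a).tsum_add (hsum b)]
    exact tsum_congr fun i => by rw [lp.coeFn_add, Pi.add_apply, add_smul]
  · rw [RingHom.id_apply, ← (hsum a).tsum_const_smul c]
    exact tsum_congr fun i => by rw [lp.coeFn_smul, Pi.smul_apply, smul_assoc]

namespace SchattenClass

variable {H : Type*} [NormedAddCommGroup H] [InnerProductSpace ℂ H]

theorem isCompactOperator_rankOne (v u : H) :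
    IsCompactOperator (InnerProductSpace.rankOne ℂ v u : H →L[ℂ] H) := by
  exact (isCompactOperator_id (E := ℂ)).comp_clm (innerSL ℂ u) |>.clm_comp
    (ContinuousLinearMap.toSpanSingleton ℂ v)

/-- From index `1` on the operator is its own approximant, so at most one singular value is nonzero.
-/
theorem memℓp_singularValue_rankOne {p : ℝ≥0∞} (v u : H) :
    Memℓp (singularValue (InnerProductSpace.rankOne ℂ v u : H →L[ℂ] H)) p := by
  refine Memℓp.of_exponent_ge (q := 0) (memℓp_zero ((Set.finite_singleton 0).subset ?_)) bot_le
  intro n hn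
  by_contra h0
  refine hn (le_antisymm ?_ (singularValue_nonneg _ _))
  have := singularValue_le (InnerProductSpace.rankOne ℂ v u : H →L[ℂ] H)
    (InnerProductSpace.rankOne ℂ v u) n ?_
  · simpa using this
  · have h1 := rank_sum_rankOne_le (fun _ => v) (fun _ => u) 1
    rw [Finset.sum_range_one] at h1
    refine h1.trans ?_
    exact_mod_cast Nat.one_le_iff_ne_zero.2 h0

/-- If `F` competes for `X`, then `A F B` has no larger rank and competes for `A X B`. -/
theorem singularValue_comp_le (A X B : H →L[ℂ] H) (n : ℕ) :
    singularValue (A ∘L X ∘L B) n ≤ ‖A‖ * ‖B‖ * singularValue X n := by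
  rcases (mul_nonneg (norm_nonneg A) (norm_nonneg B)).eq_or_lt with h | h
  · rw [← h, zero_mul]
    refine (singularValue_le_norm _ _).trans ?_
    calc _ ≤ ‖A‖ * (‖X‖ * ‖B‖) := (A.opNorm_comp_le _).trans (by
          gcongr; exact X.opNorm_comp_le _)
      _ = (‖A‖ * ‖B‖) * ‖X‖ := by ring
      _ ≤ 0 := by rw [← h, zero_mul]
  rw [← div_le_iff₀' h]
  refine le_singularValue _ _ _ fun F hF => ?_
  rw [div_le_iff₀' h]
  refine (singularValue_le _ (A ∘L F ∘L B) _ ?_).trans ?_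
  · change LinearMap.rank ((A : H →ₗ[ℂ] H) ∘ₗ (F : H →ₗ[ℂ] H) ∘ₗ (B : H →ₗ[ℂ] H)) ≤ n
    exact (LinearMap.rank_comp_le_right _ _).trans ((LinearMap.rank_comp_le_left _ _).trans hF)
  · have : A ∘L X ∘L B - A ∘L F ∘L B = A ∘L (X - F) ∘L B := by ext; simp
    rw [this]
    calc _ ≤ ‖A‖ * (‖X - F‖ * ‖B‖) := (A.opNorm_comp_le _).trans (by
          gcongr; exact (X - F).opNorm_comp_le _)
      _ = _ := by ring

variable {p : ℝ≥0∞} [Fact (1 ≤ p)] [CompleteSpace H]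

/-- The rank one operator `⟪u, ·⟫ v` as an element of `S_p(H)`. -/
def rankOne (v u : H) : SchattenClass p H :=
  ofMem (isCompactOperator_rankOne v u) (memℓp_singularValue_rankOne v u)

@[simp] theorem toOperator_rankOne (v u : H) :
    (rankOne v u : SchattenClass p H).toOperator = InnerProductSpace.rankOne ℂ v u := rfl

/-- Rank one operators along orthogonal systems have an upper `ℓ_p` estimate. -/
theorem norm_sum_smul_rankOne_le (hp : p ≠ ∞) {ι : Type*} [Fintype ι] {u v : ι → H}
    (hu : IsOrthoSystem u) (hv : IsOrthoSystem v) (c : ι → ℂ) {M : ℝ} (hM : 0 ≤ M)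
    (hc : ∑ i, ‖c i‖ ^ p.toReal ≤ M ^ p.toReal) :
    ‖∑ i, c i • (rankOne (v i) (u i) : SchattenClass p H)‖ ≤ M := by
  have hr := toReal_pos_of_ne_top hp
  refine norm_le_of_forall_sum_le hp _ hM fun n e f he hf => ?_
  -- The numbers `‖⟪v i, f j⟫‖ * ‖⟪u i, e j⟫‖` form a matrix whose row and column sums are at most
  -- `1`, by Bessel. Hölder with these weights uses the sums over `i`; the sums over `j` are used
  -- after the order of summation is exchanged.
  have hi : ∀ j, ‖⟪f j, (∑ i, c i • (rankOne (v i) (u i) : SchattenClass p H)).toOperator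
      (e j)⟫_ℂ‖ ^ p.toReal ≤ ∑ i, (‖⟪v i, f j⟫_ℂ‖ * ‖⟪u i, e j⟫_ℂ‖) * ‖c i‖ ^ p.toReal := by
    intro j
    have h1 : ‖⟪f j, (∑ i, c i • (rankOne (v i) (u i) : SchattenClass p H)).toOperator
        (e j)⟫_ℂ‖ ≤ ∑ i, (‖⟪v i, f j⟫_ℂ‖ * ‖⟪u i, e j⟫_ℂ‖) * ‖c i‖ := by
      rw [map_sum, sum_apply, inner_sum]
      refine (norm_sum_le _ _).trans (Finset.sum_le_sum fun i _ => ?_)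
      rw [map_smul, toOperator_rankOne, smul_apply, InnerProductSpace.rankOne_apply,
        inner_smul_right, inner_smul_right, norm_mul, norm_mul, norm_inner_symm (f j)]
      exact le_of_eq (by ring)
    have h2 := Real.inner_le_weight_mul_Lp_of_nonneg Finset.univ (one_le_toReal hp)
      (fun i => ‖⟪v i, f j⟫_ℂ‖ * ‖⟪u i, e j⟫_ℂ‖) (fun i => ‖c i‖)
      (fun i => by positivity) (fun i => norm_nonneg _)
    have h4 : (∑ i, ‖⟪v i, f j⟫_ℂ‖ * ‖⟪u i, e j⟫_ℂ‖) ^ (1 - p.toReal⁻¹) ≤ 1 :=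
      Real.rpow_le_one (Finset.sum_nonneg fun k _ => by positivity)
        (hv.sum_mul_inner_le hu (hf.2 j) (he.2 j))
        (sub_nonneg.2 (inv_le_one_of_one_le₀ (one_le_toReal hp)))
    have h5 : 0 ≤ ∑ i, (‖⟪v i, f j⟫_ℂ‖ * ‖⟪u i, e j⟫_ℂ‖) * ‖c i‖ ^ p.toReal :=
      Finset.sum_nonneg fun k _ => by positivity
    have h6 := (h1.trans h2).trans (mul_le_of_le_one_left (Real.rpow_nonneg h5 _) h4)
    have h7 := Real.rpow_le_rpow (norm_nonneg _) h6 hr.le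
    rwa [Real.rpow_inv_rpow h5 hr.ne'] at h7
  refine (Finset.sum_le_sum fun j _ => hi j).trans (le_trans ?_ hc)
  rw [Finset.sum_comm]
  refine Finset.sum_le_sum fun i _ => ?_
  rw [← Finset.sum_mul]
  refine mul_le_of_le_one_left (by positivity) ?_
  simp only [norm_inner_symm (v i), norm_inner_symm (u i)]
  exact hf.sum_mul_inner_le he (hv.2 i) (hu.2 i)

/-- The multipliers along two orthogonal systems embed `ℓ_p` contractively into `S_p(H)`. -/
theorem exists_diagonal (hp : p ≠ ∞) {u v : ℕ → H} (hu : IsOrthoSystem u) (hv : IsOrthoSystem v)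
    (a : lp (fun _ : ℕ => ℂ) p) : ∃ D : SchattenClass p H,
      HasSum (fun i => a i • (rankOne (v i) (u i) : SchattenClass p H)) D ∧ ‖D‖ ≤ ‖a‖ := by
  have := completeSpace (H := H) hp
  obtain ⟨J, hJ, hJn⟩ := exists_lp_map hp (fun i => (rankOne (v i) (u i) : SchattenClass p H))
    zero_le_one fun s c M hM hc => by
      rw [one_mul, ← Finset.sum_coe_sort]
      refine norm_sum_smul_rankOne_le hp (u := fun i : s => u i) (v := fun i : s => v i)
        (hu.comp Subtype.val_injective) (hv.comp Subtype.val_injective) (fun i : s => c i) hM ?_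
      rwa [Finset.sum_coe_sort s fun i => ‖c i‖ ^ p.toReal]
  exact ⟨J a, hJ a, by simpa using hJn a⟩

/-- The sequence of singular values as an element of the complex space `ℓ_p`. -/
def singularSeqC (A : SchattenClass p H) : lp (fun _ : ℕ => ℂ) p :=
  ⟨fun n => (singularValue A.toOperator n : ℂ), A.2.2.mono' fun n => by
    rw [Complex.norm_real]; rfl⟩

theorem singularSeqC_apply (A : SchattenClass p H) (n : ℕ) :
    A.singularSeqC n = (singularValue A.toOperator n : ℂ) := rfl

theorem norm_singularSeqC (hp : p ≠ ∞) (A : SchattenClass p H) : ‖A.singularSeqC‖ = ‖A‖ := by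
  have hr := toReal_pos_of_ne_top hp
  rw [← Real.rpow_left_inj (norm_nonneg _) (norm_nonneg _) hr.ne', norm_rpow_eq_tsum hp,
    lp.norm_rpow_eq_tsum hr]
  refine tsum_congr fun n => ?_
  rw [singularSeqC_apply, Complex.norm_real, Real.norm_of_nonneg (singularValue_nonneg _ _)]

/-- The singular value decomposition converges in `S_p(H)`. -/
theorem exists_schmidt_hasSum (hp : p ≠ ∞) (A : SchattenClass p H) :
    ∃ u v : ℕ → H, IsOrthoSystem u ∧ IsOrthoSystem v ∧
      (∀ n, A.toOperator (u n) = (singularValue A.toOperator n : ℂ) • v n) ∧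
      (∀ n, ⟪v n, A.toOperator (u n)⟫_ℂ = singularValue A.toOperator n) ∧
      (∀ n, singularValue A.toOperator n = 0 → u n = 0 ∧ v n = 0) ∧
      HasSum (fun i => (singularValue A.toOperator i : ℂ) •
        (rankOne (v i) (u i) : SchattenClass p H)) A := by
  obtain ⟨u, v, hu, hv, hAu, hd, h0, -, hlim, hsum⟩ := exists_schmidt_system A.isCompactOperator
  refine ⟨u, v, hu, hv, hAu, hd, h0, ?_⟩
  -- The `ℓ_p` estimate already gives unconditional convergence in `S_p`; only the limit must be
  -- identified, and for this the operator norm is enough.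
  obtain ⟨D, hD, -⟩ := exists_diagonal hp hu hv A.singularSeqC
  have h1 := (toOperatorL.hasSum hD).tendsto_sum_nat
  have h2 : Tendsto (fun n => ∑ k ∈ Finset.range n, (singularValue A.toOperator k : ℂ) •
      InnerProductSpace.rankOne ℂ (v k) (u k)) atTop (𝓝 A.toOperator) := by
    rw [tendsto_iff_norm_sub_tendsto_zero]
    exact hlim.congr fun n => by rw [norm_sub_rev, hsum]
  have h3 : D = A := toOperator_injective (tendsto_nhds_unique h1 (by simpa using! h2))
  rwa [h3] at hD

theorem memℓp_singularValue_comp (A B : H →L[ℂ] H) (X : SchattenClass p H) :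
    Memℓp (singularValue (A ∘L X.toOperator ∘L B)) p :=
  ((‖A‖ * ‖B‖) • X.singularSeq).2.mono' fun n => by
    rw [Real.norm_of_nonneg (singularValue_nonneg _ _)]
    exact (singularValue_comp_le A _ B n).trans (le_abs_self _)

/-- The two-sided multiplication `X ↦ A X B` on `S_p(H)`. -/
def sandwich (A B : H →L[ℂ] H) : SchattenClass p H →L[ℂ] SchattenClass p H :=
  LinearMap.mkContinuous
    { toFun := fun X => ofMem ((X.isCompactOperator.comp_clm B).clm_comp A)
        (memℓp_singularValue_comp A B X)
      map_add' := fun X Y => toOperator_injective (by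
        change A ∘L (X + Y).toOperator ∘L B
          = A ∘L X.toOperator ∘L B + A ∘L Y.toOperator ∘L B
        ext; simp)
      map_smul' := fun c X => toOperator_injective (by
        change A ∘L (c • X).toOperator ∘L B = c • (A ∘L X.toOperator ∘L B)
        ext; simp) } (‖A‖ * ‖B‖) fun X => by
    have hp : p ≠ 0 := (zero_lt_one.trans_le (Fact.out (p := 1 ≤ p))).ne'
    rw [norm_def X]
    refine le_trans (lp.norm_mono (y := (‖A‖ * ‖B‖) • X.singularSeq) hp fun n => ?_)
      (le_of_eq ?_)
    · change ‖singularValue (A ∘L X.toOperator ∘L B) n‖ ≤ _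
      rw [Real.norm_of_nonneg (singularValue_nonneg _ _)]
      exact (singularValue_comp_le A _ B n).trans (le_abs_self _)
    · rw [lp.norm_const_smul hp, Real.norm_of_nonneg (by positivity)]

@[simp] theorem toOperator_sandwich (A B : H →L[ℂ] H) (X : SchattenClass p H) :
    (sandwich A B X).toOperator = A ∘L X.toOperator ∘L B := rfl

theorem norm_sandwich_le (A B : H →L[ℂ] H) (X : SchattenClass p H) :
    ‖sandwich A B X‖ ≤ ‖A‖ * ‖B‖ * ‖X‖ :=
  (sandwich A B).le_of_opNorm_le
    (LinearMap.mkContinuous_norm_le _ (by positivity) _) X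

theorem norm_sandwich_le_norm {A B : H →L[ℂ] H} (hA : ‖A‖ ≤ 1) (hB : ‖B‖ ≤ 1)
    (X : SchattenClass p H) : ‖sandwich A B X‖ ≤ ‖X‖ :=
  (norm_sandwich_le A B X).trans
    (mul_le_of_le_one_left (norm_nonneg _) (mul_le_one₀ hA (norm_nonneg _) hB))

end SchattenClass

/-! ### Positive operators, heads and tails. -/

/-- The Cauchy–Schwarz inequality for a positive operator, in weighted form. -/
theorem norm_inner_le_of_isPositive {H : Type*} [NormedAddCommGroup H] [InnerProductSpace ℂ H]
    {A : H →L[ℂ] H} (hA : A.IsPositive) {t : ℝ} (ht : 0 < t) (x y : H) :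
    ‖⟪x, A y⟫_ℂ‖ ≤ t / 2 * ‖⟪x, A x⟫_ℂ‖ + t⁻¹ / 2 * ‖⟪y, A y⟫_ℂ‖ := by
  -- The phase `c` makes the mixed term real and nonnegative; positivity is then tested on `t x - c
  -- y`.
  obtain ⟨c, hc, hcz⟩ : ∃ c : ℂ, ‖c‖ = 1 ∧ c * ⟪x, A y⟫_ℂ = (‖⟪x, A y⟫_ℂ‖ : ℂ) := by
    by_cases h : ⟪x, A y⟫_ℂ = 0
    · exact ⟨1, by simp, by simp [h]⟩
    · refine ⟨‖⟪x, A y⟫_ℂ‖ / ⟪x, A y⟫_ℂ, by simp [h], by field_simp⟩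
  have h0 := hA.re_inner_nonneg_right ((t : ℂ) • x - c • y)
  have hsymm : ⟪y, A x⟫_ℂ = (starRingEnd ℂ) ⟪x, A y⟫_ℂ := by
    rw [inner_conj_symm, hA.inner_left_eq_inner_right]
  have hcc : (starRingEnd ℂ) c * c = 1 := by
    rw [mul_comm, Complex.mul_conj, Complex.normSq_eq_norm_sq, hc]; simp
  have hexp : ⟪(t : ℂ) • x - c • y, A ((t : ℂ) • x - c • y)⟫_ℂ
      = (t : ℂ) ^ 2 * ⟪x, A x⟫_ℂ + ⟪y, A y⟫_ℂ - (t : ℂ) * (c * ⟪x, A y⟫_ℂ)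
        - (t : ℂ) * (starRingEnd ℂ) (c * ⟪x, A y⟫_ℂ) := by
    simp only [map_sub, map_smul, inner_sub_left, inner_sub_right, inner_smul_left,
      inner_smul_right, Complex.conj_ofReal, map_mul, hsymm]
    linear_combination ⟪y, A y⟫_ℂ * hcc
  rw [hexp, hcz, Complex.conj_ofReal] at h0
  have hre : RCLike.re ((t : ℂ) ^ 2 * ⟪x, A x⟫_ℂ + ⟪y, A y⟫_ℂ - (t : ℂ) * (‖⟪x, A y⟫_ℂ‖ : ℂ)
        - (t : ℂ) * (‖⟪x, A y⟫_ℂ‖ : ℂ)) = t ^ 2 * (⟪x, A x⟫_ℂ).re + (⟪y, A y⟫_ℂ).re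
        - t * ‖⟪x, A y⟫_ℂ‖ - t * ‖⟪x, A y⟫_ℂ‖ := by
    rw [← Complex.ofReal_pow]
    simp only [RCLike.re_to_complex, Complex.sub_re, Complex.add_re, Complex.re_ofReal_mul,
      Complex.ofReal_re]
  rw [hre] at h0
  have h1 := Complex.re_le_norm ⟪x, A x⟫_ℂ
  have h2 := Complex.re_le_norm ⟪y, A y⟫_ℂ
  have h3 : 2 * t * ‖⟪x, A y⟫_ℂ‖ ≤ t ^ 2 * ‖⟪x, A x⟫_ℂ‖ + ‖⟪y, A y⟫_ℂ‖ := by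
    nlinarith [mul_le_mul_of_nonneg_left h1 (sq_nonneg t)]
  have h4 : t / 2 * ‖⟪x, A x⟫_ℂ‖ + t⁻¹ / 2 * ‖⟪y, A y⟫_ℂ‖
      = (t ^ 2 * ‖⟪x, A x⟫_ℂ‖ + ‖⟪y, A y⟫_ℂ‖) / (2 * t) := by field_simp
  rw [h4, le_div_iff₀ (by positivity)]
  linarith

/-- A bounded operator with finite-dimensional range is compact. -/
theorem isCompactOperator_of_forall_mem {X Y : Type*} [NormedAddCommGroup X] [NormedSpace ℂ X]
    [NormedAddCommGroup Y] [NormedSpace ℂ Y] (T : X →L[ℂ] Y) (F : Submodule ℂ Y)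
    [FiniteDimensional ℂ F] (h : ∀ x, T x ∈ F) : IsCompactOperator T := by
  have := FiniteDimensional.proper ℂ F
  exact (isCompactOperator_of_locallyCompactSpace_dom (T.codRestrict F h)).clm_comp F.subtypeL

namespace SchattenClass

section Projections

variable {H : Type*} [NormedAddCommGroup H] [InnerProductSpace ℂ H]

/-- The orthogonal projection onto the span of a finite set. -/
def headProj (S : Finset H) : H →L[ℂ] H := (Submodule.span ℂ (S : Set H)).starProjection

/-- The orthogonal projection onto the orthogonal complement of a finite set. -/
def tailProj (S : Finset H) : H →L[ℂ] H := (Submodule.span ℂ (S : Set H))ᗮ.starProjection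

theorem norm_headProj_le (S : Finset H) : ‖headProj S‖ ≤ 1 := Submodule.starProjection_norm_le _

theorem norm_tailProj_le (S : Finset H) : ‖tailProj S‖ ≤ 1 := Submodule.starProjection_norm_le _

theorem headProj_add_tailProj (S : Finset H) (x : H) : headProj S x + tailProj S x = x := by
  rw [tailProj, Submodule.starProjection_orthogonal]
  simp [headProj]

theorem inner_headProj_left (S : Finset H) (x y : H) :
    ⟪headProj S x, y⟫_ℂ = ⟪x, headProj S y⟫_ℂ :=
  Submodule.inner_starProjection_left_eq_right _ _ _

theorem inner_tailProj_left (S : Finset H) (x y : H) :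
    ⟪tailProj S x, y⟫_ℂ = ⟪x, tailProj S y⟫_ℂ :=
  Submodule.inner_starProjection_left_eq_right _ _ _

theorem tailProj_eq_zero {S : Finset H} {x : H} (hx : x ∈ S) : tailProj S x = 0 := by
  rw [tailProj, Submodule.starProjection_apply_eq_zero_iff]
  exact Submodule.le_orthogonal_orthogonal _ (Submodule.subset_span hx)

theorem tailProj_eq_self {S : Finset H} {x : H} (hx : ∀ y ∈ S, ⟪y, x⟫_ℂ = 0) :
    tailProj S x = x := by
  rw [tailProj, Submodule.starProjection_eq_self_iff, Submodule.mem_orthogonal]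
  intro u hu
  induction hu using Submodule.span_induction with
  | mem y hy => exact hx y hy
  | zero => simp
  | add a b _ _ ha hb => rw [inner_add_left, ha, hb, add_zero]
  | smul c a _ ha => rw [inner_smul_left, ha, mul_zero]

theorem tailProj_tailProj_of_subset {S S' : Finset H} (h : S ⊆ S') (x : H) :
    tailProj S (tailProj S' x) = tailProj S' x := by
  refine tailProj_eq_self fun y hy => ?_
  rw [← inner_tailProj_left, tailProj_eq_zero (h hy), inner_zero_left]

theorem tailProj_tailProj_of_subset' {S S' : Finset H} (h : S ⊆ S') (x : H) :
    tailProj S' (tailProj S x) = tailProj S' x := by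
  refine ext_inner_right ℂ fun y => ?_
  rw [inner_tailProj_left, inner_tailProj_left, tailProj_tailProj_of_subset h,
    inner_tailProj_left]

end Projections

variable {H : Type*} [NormedAddCommGroup H] [InnerProductSpace ℂ H] [CompleteSpace H]
variable {p : ℝ≥0∞} [Fact (1 ≤ p)]

/-- Cauchy–Schwarz with `t = 1` bounds every coefficient of `A` by the mean of two diagonal ones,
and these grow from `A` to `B`. -/
theorem norm_le_of_isPositive_sub (hp : p ≠ ∞) {A B : SchattenClass p H}
    (hA : A.toOperator.IsPositive) (hAB : (B - A).toOperator.IsPositive) : ‖A‖ ≤ ‖B‖ := by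
  have hle : ∀ x, ‖⟪x, A.toOperator x⟫_ℂ‖ ≤ ‖⟪x, B.toOperator x⟫_ℂ‖ := by
    intro x
    have h1 := hA.inner_nonneg_right x
    have h2 := hAB.inner_nonneg_right x
    rw [map_sub, sub_apply, inner_sub_right, sub_nonneg] at h2
    exact CStarAlgebra.norm_le_norm_of_nonneg_of_le h1 h2
  have := norm_le_of_forall_inner_le hp A B B (a := 1 / 2) (b := 1 / 2) (by norm_num)
    (by norm_num) fun e f => by
      have h := norm_inner_le_of_isPositive hA one_pos f e
      have h1 := hle e
      have h2 := hle f
      norm_num at h ⊢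
      linarith
  linarith

/-- The compression of `X` to the span of a finite set. -/
def head (S : Finset H) : SchattenClass p H →L[ℂ] SchattenClass p H :=
  sandwich (headProj S) (headProj S)

/-- The compression of `X` to the orthogonal complement of a finite set. -/
def tail (S : Finset H) : SchattenClass p H →L[ℂ] SchattenClass p H :=
  sandwich (tailProj S) (tailProj S)

theorem toOperator_head_apply (S : Finset H) (X : SchattenClass p H) (x : H) :
    (head S X).toOperator x = headProj S (X.toOperator (headProj S x)) := rfl

theorem toOperator_tail_apply (S : Finset H) (X : SchattenClass p H) (x : H) :
    (tail S X).toOperator x = tailProj S (X.toOperator (tailProj S x)) := rfl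

theorem norm_head_le (S : Finset H) (X : SchattenClass p H) : ‖head S X‖ ≤ ‖X‖ :=
  norm_sandwich_le_norm (norm_headProj_le S) (norm_headProj_le S) X

theorem norm_tail_le (S : Finset H) (X : SchattenClass p H) : ‖tail S X‖ ≤ ‖X‖ :=
  norm_sandwich_le_norm (norm_tailProj_le S) (norm_tailProj_le S) X

theorem tail_tail_of_subset {S S' : Finset H} (h : S ⊆ S') (X : SchattenClass p H) :
    tail S' (tail S X) = tail S' X := by
  refine toOperator_injective (ContinuousLinearMap.ext fun x => ?_)
  simp only [toOperator_tail_apply]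
  rw [tailProj_tailProj_of_subset h, tailProj_tailProj_of_subset' h]

theorem norm_tail_le_of_subset {S S' : Finset H} (h : S ⊆ S') (X : SchattenClass p H) :
    ‖tail S' X‖ ≤ ‖tail S X‖ := by
  rw [← tail_tail_of_subset h]
  exact norm_tail_le _ _

theorem isPositive_tail (S : Finset H) {A : SchattenClass p H} (hA : A.toOperator.IsPositive) :
    (tail S A).toOperator.IsPositive :=
  hA.conj_starProjection (Submodule.span ℂ (S : Set H))ᗮ

/-- A positive operator is dominated by twice its block diagonal part. -/
theorem isPositive_two_smul_head_add_tail_sub (S : Finset H) {A : SchattenClass p H}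
    (hA : A.toOperator.IsPositive) :
    ((2 : ℂ) • (head S A + tail S A) - A).toOperator.IsPositive := by
  rw [ContinuousLinearMap.isPositive_iff_complex]
  intro x
  -- The identity behind this is `2(PAP + QAQ) - A = (P - Q)A(P - Q)`.
  have h := (ContinuousLinearMap.isPositive_iff_complex _).1 hA (headProj S x - tailProj S x)
  have hx := headProj_add_tailProj S x
  have h1 : ⟪A.toOperator x, x⟫_ℂ = ⟪A.toOperator (headProj S x + tailProj S x),
    headProj S x + tailProj S x⟫_ℂ := by rw [hx]
  have key : ⟪((2 : ℂ) • (head S A + tail S A) - A).toOperator x, x⟫_ℂ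
      = ⟪A.toOperator (headProj S x - tailProj S x), headProj S x - tailProj S x⟫_ℂ := by
    rw [map_sub, sub_apply, map_smul, smul_apply, map_add, add_apply, inner_sub_left,
      inner_smul_left, inner_add_left, toOperator_head_apply, toOperator_tail_apply,
      inner_headProj_left, inner_tailProj_left, h1]
    simp only [map_add, map_sub, inner_add_left, inner_add_right, inner_sub_left,
      inner_sub_right, Complex.conj_ofNat]
    ring
  rw [key]
  exact h

/-- A positive operator with small tail is close to its head. -/
theorem norm_sub_head_le (hp : p ≠ ∞) (S : Finset H) {A : SchattenClass p H}
    (hA : A.toOperator.IsPositive) {t : ℝ} (ht : 0 < t) :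
    ‖A - head S A‖ ≤ t * ‖A‖ + t⁻¹ * ‖tail S A‖ := by
  have htail : ∀ x, ⟪tailProj S x, A.toOperator (tailProj S x)⟫_ℂ
      = ⟪x, (tail S A).toOperator x⟫_ℂ := fun x => by
    rw [inner_tailProj_left, toOperator_tail_apply]
  have hhead : ∀ x, ⟪headProj S x, A.toOperator (headProj S x)⟫_ℂ
      = ⟪x, (head S A).toOperator x⟫_ℂ := fun x => by
    rw [inner_headProj_left, toOperator_head_apply]
  -- In `A - PAP = QA + PAQ` each summand has a `Q` on one side. Cauchy–Schwarz puts the weight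
  -- `t⁻¹` on the tail and `t` on the other, merely bounded factor.
  have h1 : ‖sandwich (tailProj S) (.id ℂ H) A‖ ≤ t⁻¹ / 2 * ‖tail S A‖ + t / 2 * ‖A‖ := by
    refine norm_le_of_forall_inner_le hp _ _ _ (by positivity) (by positivity) fun e f => ?_
    have := norm_inner_le_of_isPositive hA (inv_pos.2 ht) (tailProj S f) e
    rwa [htail, inv_inv, inner_tailProj_left] at this
  have h2 : ‖sandwich (headProj S) (tailProj S) A‖
      ≤ t / 2 * ‖head S A‖ + t⁻¹ / 2 * ‖tail S A‖ := by
    refine norm_le_of_forall_inner_le hp _ _ _ (by positivity) (by positivity) fun e f => ?_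
    have := norm_inner_le_of_isPositive hA ht (headProj S f) (tailProj S e)
    rwa [htail, hhead, inner_headProj_left] at this
  have h3 : A - head S A = sandwich (tailProj S) (.id ℂ H) A
      + sandwich (headProj S) (tailProj S) A := by
    refine toOperator_injective (ContinuousLinearMap.ext fun x => ?_)
    rw [map_sub, map_add, sub_apply, add_apply, toOperator_head_apply]
    change _ = tailProj S (A.toOperator x) + headProj S (A.toOperator (tailProj S x))
    have e1 := headProj_add_tailProj S (A.toOperator x)
    have e2 : headProj S (A.toOperator x) = headProj S (A.toOperator (headProj S x))
        + headProj S (A.toOperator (tailProj S x)) := by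
      rw [← map_add, ← map_add, headProj_add_tailProj]
    rw [sub_eq_iff_eq_add]
    calc A.toOperator x = _ := e1.symm
      _ = _ := by rw [e2]; abel
  rw [h3]
  have h4 := mul_le_mul_of_nonneg_left (norm_head_le S A) (by positivity : 0 ≤ t / 2)
  calc _ ≤ _ := norm_add_le _ _
    _ ≤ _ := add_le_add h1 h2
    _ ≤ _ := by linarith

/-- The tails of an element of `S_p(H)` tend to zero. -/
theorem exists_norm_tail_lt (hp : p ≠ ∞) (X : SchattenClass p H) {ε : ℝ} (hε : 0 < ε) :
    ∃ S₀ : Finset H, ∀ S, S₀ ⊆ S → ‖tail S X‖ < ε := by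
  classical
  obtain ⟨u, v, -, -, -, -, -, hsum⟩ := exists_schmidt_hasSum hp X
  obtain ⟨s, hs⟩ := ((Metric.tendsto_nhds.1 hsum) ε hε).exists
  -- Once `S` contains the right singular vectors of a partial sum, `Q` annihilates them, so the
  -- tail sees only the remainder.
  refine ⟨s.image u, fun S hS => ?_⟩
  have h0 : tail S (∑ i ∈ s, (singularValue X.toOperator i : ℂ) •
      (rankOne (v i) (u i) : SchattenClass p H)) = 0 := by
    rw [map_sum]
    refine Finset.sum_eq_zero fun i hi => toOperator_injective (ContinuousLinearMap.ext fun x => ?_)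
    have hu : u i ∈ S := hS (Finset.mem_image_of_mem u hi)
    rw [map_smul, map_smul, smul_apply, toOperator_tail_apply, toOperator_rankOne,
      InnerProductSpace.rankOne_apply, ← inner_tailProj_left, tailProj_eq_zero hu]
    simp
  have : tail S X = tail S (X - ∑ i ∈ s, (singularValue X.toOperator i : ℂ) •
      (rankOne (v i) (u i) : SchattenClass p H)) := by rw [map_sub, h0, sub_zero]
  rw [this]
  refine (norm_tail_le _ _).trans_lt ?_
  rwa [dist_comm, dist_eq_norm] at hs

/-- Taking tails is contractive, so it is enough to treat a finite `ε / 2`-net and to unite the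
finite sets that it requires. -/
theorem exists_forall_norm_tail_lt (hp : p ≠ ∞) {K : Set (SchattenClass p H)}
    (hK : TotallyBounded K) {ε : ℝ} (hε : 0 < ε) :
    ∃ S₀ : Finset H, ∀ S, S₀ ⊆ S → ∀ X ∈ K, ‖tail S X‖ < ε := by
  classical
  obtain ⟨t, ht, htK⟩ := Metric.totallyBounded_iff.1 hK (ε / 2) (by positivity)
  choose S₀ hS₀ using fun X : SchattenClass p H => exists_norm_tail_lt hp X (half_pos hε)
  refine ⟨ht.toFinset.biUnion S₀, fun S hS X hX => ?_⟩
  obtain ⟨Y, hY, hXY⟩ := Set.mem_iUnion₂.1 (htK hX)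
  have h1 := hS₀ Y S ((Finset.subset_biUnion_of_mem S₀ (ht.mem_toFinset.2 hY)).trans hS)
  have h2 := norm_tail_le S (X - Y)
  rw [Metric.mem_ball, dist_eq_norm] at hXY
  have h3 : tail S X = tail S (X - Y) + tail S Y := by rw [map_sub, sub_add_cancel]
  rw [h3]
  linarith [norm_add_le (tail S (X - Y)) (tail S Y)]

/-- The range lies in the span of the finitely many matrix units of an orthonormal basis of the span
of `S`. -/
theorem isCompactOperator_head (S : Finset H) :
    IsCompactOperator (head S : SchattenClass p H →L[ℂ] SchattenClass p H) := by
  set b := stdOrthonormalBasis ℂ (Submodule.span ℂ (S : Set H)) with hb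
  set F : Submodule ℂ (SchattenClass p H) := Submodule.span ℂ
    (Set.range fun ij : Fin _ × Fin _ => rankOne (b ij.1 : H) (b ij.2 : H)) with hF
  have : FiniteDimensional ℂ F := FiniteDimensional.span_of_finite ℂ (Set.finite_range _)
  refine isCompactOperator_of_forall_mem (head S) F fun X => ?_
  have : head S X = ∑ i, ∑ j, ⟪(b i : H), X.toOperator (b j)⟫_ℂ •
      (rankOne (b i : H) (b j : H) : SchattenClass p H) := by
    refine toOperator_injective (ContinuousLinearMap.ext fun x => ?_)
    rw [toOperator_head_apply, headProj, b.starProjection_eq_sum_rankOne]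
    simp only [map_sum, map_smul, sum_apply, smul_apply, toOperator_rankOne,
      InnerProductSpace.rankOne_apply, Finset.smul_sum, smul_smul]
    rw [Finset.sum_comm]
    refine Finset.sum_congr rfl fun i _ => Finset.sum_congr rfl fun j _ => ?_
    rw [mul_comm]
  rw [this]
  exact Submodule.sum_mem _ fun i _ => Submodule.sum_mem _ fun j _ => Submodule.smul_mem _ _
    (Submodule.subset_span ⟨(i, j), rfl⟩)

end SchattenClass

/-! ### A compactness criterion for positive maps, and its failure. -/

namespace SchattenClass

variable {H : Type*} [NormedAddCommGroup H] [InnerProductSpace ℂ H] [CompleteSpace H]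
variable {p : ℝ≥0∞} [Fact (1 ≤ p)]

theorem isPositive_of_hasSum {ι : Type*} {f : ι → SchattenClass p H} {A : SchattenClass p H}
    (hA : HasSum f A) (hf : ∀ i, (f i).toOperator.IsPositive) : A.toOperator.IsPositive := by
  rw [ContinuousLinearMap.isPositive_iff_complex]
  intro x
  have h1 : HasSum (fun i => ⟪x, (f i).toOperator x⟫_ℂ) ⟪x, A.toOperator x⟫_ℂ :=
    hA.mapL ((innerSL ℂ x) ∘L (ContinuousLinearMap.apply ℂ H x) ∘L toOperatorL)
  have h2 : 0 ≤ ⟪x, A.toOperator x⟫_ℂ := h1.nonneg fun i => (hf i).inner_nonneg_right x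
  have h3 : ⟪A.toOperator x, x⟫_ℂ = ⟪x, A.toOperator x⟫_ℂ := by
    rw [← inner_conj_symm, Complex.conj_eq_iff_im.2 (Complex.nonneg_iff.1 h2).2.symm]
  rw [h3]
  refine ⟨?_, (Complex.nonneg_iff.1 h2).1⟩
  exact Complex.ext (by simp) (by simpa using (Complex.nonneg_iff.1 h2).2)

theorem isPositive_smul_rankOne_self {s : ℝ} (hs : 0 ≤ s) (w : H) :
    ((s : ℂ) • (rankOne w w : SchattenClass p H)).toOperator.IsPositive := by
  rw [map_smul, toOperator_rankOne]
  exact (InnerProductSpace.isPositive_rankOne_self w).smul_of_nonneg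
    (Complex.zero_le_real.2 hs)

/-- Every element of `S_p(H)` is a combination of four positive ones. -/
theorem exists_isPositive_decomposition (hp : p ≠ ∞) (A : SchattenClass p H) :
    ∃ P : Fin 4 → SchattenClass p H, (∀ k, (P k).toOperator.IsPositive) ∧
      (∀ k, ‖P k‖ ≤ 4 * ‖A‖) ∧ A = ∑ k : Fin 4, (Complex.I ^ (k : ℕ) / 4) • P k := by
  obtain ⟨u, v, hu, hv, -, -, -, hsum⟩ := exists_schmidt_hasSum hp A
  obtain ⟨B, hB, hBn⟩ := exists_diagonal hp hv hv A.singularSeqC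
  obtain ⟨C, hC, hCn⟩ := exists_diagonal hp hu hu A.singularSeqC
  obtain ⟨D, hD, hDn⟩ := exists_diagonal hp hv hu A.singularSeqC
  rw [norm_singularSeqC hp] at hBn hCn hDn
  have hI : ∀ k : ℕ, ‖Complex.I ^ k‖ = 1 := fun k => by simp
  -- Polarization: with `ζ = I ^ k`, the `k`-th term is the sum of the positive operators `s i •
  -- rankOne w w` for `w = v i + ζ • u i`. In the sum weighted by `ζ / 4` only the `A` components
  -- survive.
  refine ⟨fun k => B + C + Complex.I ^ (k : ℕ) • D + (starRingEnd ℂ) (Complex.I ^ (k : ℕ)) • A,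
    fun k => ?_, fun k => ?_, ?_⟩
  · have h := ((hB.add hC).add (hD.const_smul (Complex.I ^ (k : ℕ)))).add
      (hsum.const_smul ((starRingEnd ℂ) (Complex.I ^ (k : ℕ))))
    refine isPositive_of_hasSum h fun i => ?_
    have := isPositive_smul_rankOne_self (p := p) (singularValue_nonneg A.toOperator i)
      (v i + Complex.I ^ (k : ℕ) • u i)
    convert! this using 1
    refine congrArg _ (toOperator_injective (ContinuousLinearMap.ext fun x => ?_))
    have hk : (starRingEnd ℂ) (Complex.I ^ (k : ℕ)) * Complex.I ^ (k : ℕ) = 1 := by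
      rw [mul_comm, Complex.mul_conj, Complex.normSq_eq_norm_sq, hI]; simp
    simp only [map_add, map_smul, add_apply, smul_apply, toOperator_rankOne,
      InnerProductSpace.rankOne_apply, singularSeqC_apply, map_smulₛₗ]
    match_scalars
    · ring
    · linear_combination -(singularValue A.toOperator i : ℂ) * ⟪u i, x⟫_ℂ * hk
  · have h1 : ‖Complex.I ^ (k : ℕ) • D‖ ≤ ‖A‖ := by rw [norm_smul, hI, one_mul]; exact hDn
    have h2 : ‖(starRingEnd ℂ) (Complex.I ^ (k : ℕ)) • A‖ ≤ ‖A‖ := by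
      rw [norm_smul, RCLike.norm_conj, hI, one_mul]
    calc _ ≤ ‖B‖ + ‖C‖ + ‖Complex.I ^ (k : ℕ) • D‖
          + ‖(starRingEnd ℂ) (Complex.I ^ (k : ℕ)) • A‖ := norm_add₄_le
      _ ≤ _ := by linarith
  · simp only [Fin.sum_univ_four, Fin.val_zero, Fin.val_one, Fin.val_two, smul_add, smul_smul,
      show ((3 : Fin 4) : ℕ) = 3 from rfl]
    match_scalars <;> norm_num [Complex.ext_iff, pow_succ, Complex.div_re, Complex.div_im]

/-- Each of the four positive parts has norm at most `4 * ‖A‖` and coefficient of modulus `1 / 4`,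
so each contributes at most `M * ‖A‖`. -/
theorem norm_le_of_forall_isPositive (hp : p ≠ ∞) {Y : Type*} [NormedAddCommGroup Y]
    [NormedSpace ℂ Y] (N : SchattenClass p H →L[ℂ] Y) {M : ℝ} (hM : 0 ≤ M)
    (h : ∀ A : SchattenClass p H, A.toOperator.IsPositive → ‖N A‖ ≤ M * ‖A‖) :
    ‖N‖ ≤ 4 * M := by
  refine N.opNorm_le_bound (by positivity) fun A => ?_
  obtain ⟨P, hP, hPn, hA⟩ := exists_isPositive_decomposition hp A
  have hk : ∀ k : Fin 4, ‖(Complex.I ^ (k : ℕ) / 4) • N (P k)‖ ≤ M * ‖A‖ := fun k => by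
    rw [norm_smul]
    have h1 : ‖Complex.I ^ (k : ℕ) / 4‖ = 1 / 4 := by simp
    rw [h1]
    have := (h _ (hP k)).trans (mul_le_mul_of_nonneg_left (hPn k) hM)
    linarith
  calc ‖N A‖ = ‖∑ k : Fin 4, (Complex.I ^ (k : ℕ) / 4) • N (P k)‖ := by
        conv_lhs => rw [hA, map_sum]
        simp only [map_smul]
    _ ≤ ∑ _k : Fin 4, M * ‖A‖ := (norm_sum_le _ _).trans (Finset.sum_le_sum fun k _ => hk k)
    _ = 4 * M * ‖A‖ := by simp; ring

theorem isPositive_smul {A : SchattenClass p H} (hA : A.toOperator.IsPositive) {s : ℝ}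
    (hs : 0 ≤ s) : ((s : ℂ) • A).toOperator.IsPositive := by
  rw [map_smul]
  exact hA.smul_of_nonneg (Complex.zero_le_real.2 hs)

/-- A positive map is compact if it has uniformly small tails on the positive part of the unit
ball. -/
theorem isCompactOperator_of_forall_exists_norm_tail_le (hp : p ≠ ∞)
    {T : SchattenClass p H →L[ℂ] SchattenClass p H} (hT : IsPositiveMap T)
    (h : ∀ δ > 0, ∃ S : Finset H, ∀ A : SchattenClass p H, A.toOperator.IsPositive → ‖A‖ ≤ 1 →
      ‖tail S (T A)‖ ≤ δ) : IsCompactOperator T := by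
  have := completeSpace (H := H) hp
  have key : ∀ n : ℕ, ∃ S : Finset H, ‖T - head S ∘L T‖ ≤ 4 * ((‖T‖ + 1) / (n + 1)) := by
    intro n
    have hn : (0 : ℝ) < 1 / (n + 1) := by positivity
    -- With `t = 1 / (n + 1)` and tails at most `t ^ 2`, the bound `t * ‖T B‖ + t⁻¹ * t ^ 2` is at
    -- most `t * (‖T‖ + 1)`.
    obtain ⟨S, hS⟩ := h ((1 / (n + 1)) ^ 2) (by positivity)
    refine ⟨S, norm_le_of_forall_isPositive hp _ (by positivity) fun A hA => ?_⟩
    have hball : ∀ B : SchattenClass p H, B.toOperator.IsPositive → ‖B‖ ≤ 1 →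
        ‖(T - head S ∘L T) B‖ ≤ (‖T‖ + 1) / (n + 1) := by
      intro B hB hB1
      have h1 := norm_sub_head_le hp S (hT B hB) hn
      have h2 := hS B hB hB1
      have h3 : ‖T B‖ ≤ ‖T‖ := (T.le_opNorm B).trans (mul_le_of_le_one_right (norm_nonneg _) hB1)
      have h4 := mul_le_mul_of_nonneg_left h3 hn.le
      have h5 := mul_le_mul_of_nonneg_left h2 (inv_pos.2 hn).le
      have h6 : ((1 : ℝ) / (n + 1))⁻¹ * (1 / (n + 1)) ^ 2 = 1 / (n + 1) := by
        rw [sq, ← mul_assoc, inv_mul_cancel₀ hn.ne', one_mul]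
      calc ‖(T - head S ∘L T) B‖ ≤ _ := h1
        _ ≤ 1 / (n + 1) * ‖T‖ + 1 / (n + 1) := by linarith
        _ = _ := by ring
    rcases (norm_nonneg A).eq_or_lt with h0 | h0
    · rw [norm_eq_zero.1 h0.symm]; simp
    · have hB := hball (((‖A‖⁻¹ : ℝ) : ℂ) • A) (isPositive_smul hA (by positivity)) (by
        rw [norm_smul, Complex.norm_real, norm_inv, norm_norm, inv_mul_cancel₀ h0.ne'])
      rw [map_smul, norm_smul, Complex.norm_real, norm_inv, norm_norm,
        inv_mul_le_iff₀ h0] at hB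
      linarith
  choose S hS using key
  refine isCompactOperator_of_tendsto (F := fun n => head (S n) ∘L T) (l := atTop) ?_
    (Eventually.of_forall fun n => (isCompactOperator_head (S n)).comp_clm T)
  rw [tendsto_iff_norm_sub_tendsto_zero]
  have hlim : Tendsto (fun n : ℕ => 4 * ((‖T‖ + 1) / ((n : ℝ) + 1))) atTop (𝓝 0) := by
    have := (tendsto_one_div_add_atTop_nhds_zero_nat (𝕜 := ℝ)).const_mul (4 * (‖T‖ + 1))
    rw [mul_zero] at this
    exact this.congr fun n => by ring
  exact squeeze_zero (fun _ => norm_nonneg _) (fun n => by rw [norm_sub_rev]; exact hS n) hlim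

/-- A positive map that is not compact has, beyond all finite-dimensional subspaces and on the
kernel of all finite-dimensional maps, elements whose images have large tails. -/
theorem exists_le_norm_tail_of_not_isCompactOperator (hp : p ≠ ∞)
    {T : SchattenClass p H →L[ℂ] SchattenClass p H} (hT : IsPositiveMap T)
    (hnc : ¬ IsCompactOperator T) :
    ∃ δ > 0, ∀ (S S' : Finset H) (ι : Type*) [Fintype ι] (Ψ : SchattenClass p H →L[ℂ] (ι → ℂ)),
      ∀ ε > 0, ∃ C : SchattenClass p H, tail S C = C ∧ ‖C‖ ≤ 2 ∧ ‖Ψ C‖ ≤ ε ∧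
        δ ≤ ‖tail S' (T C)‖ := by
  classical
  by_contra! hcon
  refine hnc (isCompactOperator_of_forall_exists_norm_tail_le hp hT fun η hη => ?_)
  -- The budget is `2 * (η / 6 + (η / 6 + η / 6)) = η`: one share for the head of `A`, one for a net
  -- point approximating its tail, one for the difference. The outer `2` comes from the domination
  -- by the block diagonal part.
  obtain ⟨S, S', ι, _, Ψ, ε, hε, hC⟩ := hcon (η / 6) (by positivity)
  set B : Set (SchattenClass p H) :=
    {A | A.toOperator.IsPositive ∧ ‖A‖ ≤ 1 ∧ tail S A = A} with hB
  have hbdd : Bornology.IsBounded (Ψ '' B) := by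
    refine (Metric.isBounded_closedBall (x := (0 : ι → ℂ)) (r := ‖Ψ‖)).subset ?_
    rintro _ ⟨A, hA, rfl⟩
    rw [mem_closedBall_zero_iff]
    exact (Ψ.le_opNorm A).trans (mul_le_of_le_one_right (norm_nonneg _) hA.2.1)
  -- The target of `Ψ` is finite-dimensional, so `Ψ '' B` has a finite `ε`-net with points in `Ψ ''
  -- B`. The difference of an element of `B` and a net point has norm at most `2` and small image
  -- under `Ψ`, so `hC` applies to it although it need not be positive.
  obtain ⟨t, htB, ht, hcov⟩ := Metric.finite_approx_of_totallyBounded 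
    (hbdd.isCompact_closure.totallyBounded.subset subset_closure) ε hε
  obtain ⟨t', ht'B, ht', rfl⟩ := ht.exists_subset_finite_image_eq htB
  obtain ⟨S₁, hS₁⟩ := exists_forall_norm_tail_lt hp (K := T '' t')
    (ht'.image T).isCompact.totallyBounded
    (show 0 < η / 6 by positivity)
  obtain ⟨S₂, hS₂⟩ := exists_forall_norm_tail_lt hp
    (K := (T ∘L head S) '' Metric.closedBall 0 1) (by
      obtain ⟨K, hK, hKs⟩ := ((isCompactOperator_head S).clm_comp T).image_closedBall_subset_compact
        (𝕜₁ := ℂ) (f := (T ∘L head S : SchattenClass p H →ₗ[ℂ] SchattenClass p H)) 1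
      exact hK.totallyBounded.subset hKs) (show 0 < η / 6 by positivity)
  refine ⟨S' ∪ S₁ ∪ S₂, fun A hA hA1 => ?_⟩
  set R := S' ∪ S₁ ∪ S₂ with hR
  have hAB : tail S A ∈ B :=
    ⟨isPositive_tail S hA, (norm_tail_le S A).trans hA1, tail_tail_of_subset subset_rfl A⟩
  have h1 : ‖tail R (T (head S A))‖ < η / 6 :=
    hS₂ R Finset.subset_union_right _ ⟨A, by simpa using hA1, rfl⟩
  have h2 : ‖tail R (T (tail S A))‖ < η / 3 := by
    obtain ⟨_, ⟨C, hCt, rfl⟩, hAC⟩ := Set.mem_iUnion₂.1 (hcov ⟨_, hAB, rfl⟩)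
    have hB' := ht'B hCt
    have h3 := hC (tail S A - C) (by rw [map_sub, hAB.2.2, hB'.2.2])
      (by linarith [norm_sub_le (tail S A) C, hAB.2.1, hB'.2.1])
      (by rw [map_sub, ← dist_eq_norm]; exact (Metric.mem_ball.1 hAC).le)
    have h4 := norm_tail_le_of_subset (S := S') (S' := R)
      (Finset.subset_union_left.trans Finset.subset_union_left) (T (tail S A - C))
    have h5 := hS₁ R (Finset.subset_union_right.trans Finset.subset_union_left) _ ⟨C, hCt, rfl⟩
    have h6 : tail R (T (tail S A)) = tail R (T (tail S A - C)) + tail R (T C) := by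
      rw [← map_add, ← map_add, sub_add_cancel]
    rw [h6]
    linarith [norm_add_le (tail R (T (tail S A - C))) (tail R (T C))]
  -- Here positivity of `T` enters: it preserves the domination of `A` by its head and tail.
  have h3 : (tail R ((2 : ℂ) • (T (head S A) + T (tail S A)) - T A)).toOperator.IsPositive := by
    refine isPositive_tail R ?_
    rw [← map_add, ← map_smul, ← map_sub]
    exact hT _ (isPositive_two_smul_head_add_tail_sub S hA)
  rw [map_sub] at h3
  refine (norm_le_of_isPositive_sub hp (isPositive_tail R (hT A hA)) h3).trans ?_
  rw [map_smul, map_add, norm_smul]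
  have h4 := norm_add_le (tail R (T (head S A))) (tail R (T (tail S A)))
  simp only [Complex.norm_ofNat]
  linarith

end SchattenClass

/-! ### Factorization of the identity of `ℓ_p`, and the two soft implications. -/

section Factorization

variable {X Y : Type*} [NormedAddCommGroup X] [NormedSpace ℂ X]
  [NormedAddCommGroup Y] [NormedSpace ℂ Y]

/-- If the identity of `ℓ_p` factors through `T`, then `T` preserves a complemented copy
of `ℓ_p`. -/
theorem preservesComplementedCopy_of_comp_eq_id {p : ℝ≥0∞} [Fact (1 ≤ p)] (T : X →L[ℂ] Y)
    (J : lp (fun _ : ℕ => ℂ) p →L[ℂ] X) (L : Y →L[ℂ] lp (fun _ : ℕ => ℂ) p)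
    (h : ∀ a, L (T (J a)) = a) : PreservesComplementedCopy p T := by
  -- On `E` the inverse of `T` is `J ∘ L`. The projections onto `E` and `T(E)` are `J ∘ L ∘ T` and
  -- `T ∘ J ∘ L`.
  set E : Submodule ℂ X := LinearMap.range (J : lp (fun _ : ℕ => ℂ) p →ₗ[ℂ] X) with hE
  have hJ : ∀ a, J a ∈ E := fun a => ⟨a, rfl⟩
  have hTJ : ∀ a, T (J a) ∈ E.map (T : X →ₗ[ℂ] Y) := fun a => ⟨J a, hJ a, rfl⟩
  have hEJ : ∀ x ∈ E, J (L (T x)) = x := by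
    rintro _ ⟨a, rfl⟩
    exact congrArg J (h a)
  have hFJ : ∀ y ∈ E.map (T : X →ₗ[ℂ] Y), T (J (L y)) = y := by
    rintro _ ⟨x, hx, rfl⟩
    exact congrArg T (hEJ x hx)
  refine ⟨E, ⟨?_⟩, ⟨?_, ?_⟩, ⟨(J ∘L L ∘L T).codRestrict E fun x => hJ _, fun x => ?_⟩,
    ⟨(T ∘L J ∘L L).codRestrict _ fun x => hTJ _, fun y => ?_⟩⟩
  · exact ContinuousLinearEquiv.equivOfInverse (L ∘L T ∘L E.subtypeL) (J.codRestrict E hJ)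
      (fun x => Subtype.ext (hEJ x x.2)) h
  · exact ContinuousLinearEquiv.equivOfInverse
      ((T ∘L E.subtypeL).codRestrict _ fun x => ⟨x, x.2, rfl⟩)
      ((J ∘L L ∘L Submodule.subtypeL _).codRestrict E fun _ => hJ _)
      (fun x => Subtype.ext (hEJ x x.2)) (fun y => Subtype.ext (hFJ y y.2))
  · exact fun x => rfl
  · exact Subtype.ext (hEJ x x.2)
  · exact Subtype.ext (hFJ y y.2)

/-- A bounded operator on `ℓ_p` whose matrix is close to the identity is invertible. -/
theorem exists_comp_eq_id_of_norm_sub_le {p : ℝ≥0∞} [Fact (1 ≤ p)] (hp : p ≠ ∞)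
    (N : lp (fun _ : ℕ => ℂ) p →L[ℂ] lp (fun _ : ℕ => ℂ) p)
    (hN : ∀ j k : ℕ, ‖N (lp.single p k 1) j - (Pi.single k 1 : ℕ → ℂ) j‖
      ≤ (1 / 2) ^ j * (1 / 2) ^ k / 8) :
    ∃ N' : lp (fun _ : ℕ => ℂ) p →L[ℂ] lp (fun _ : ℕ => ℂ) p, ∀ a, N' (N a) = a := by
  have hp0 : p ≠ 0 := (zero_lt_one.trans_le (Fact.out (p := 1 ≤ p))).ne'
  have hgeom := hasSum_geometric_two
  have hcol : ∀ k, ‖(1 - N) (lp.single p k 1)‖ ≤ (1 / 2) ^ k / 4 := by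
    intro k
    have h1 := lp.hasSum_single hp ((1 - N) (lp.single p k 1))
    have h2 := hgeom.mul_right ((1 / 2 : ℝ) ^ k / 8)
    refine (h1.norm_le_of_bounded h2 fun j => ?_).trans (le_of_eq (by ring))
    rw [lp.norm_single (pos_iff_ne_zero.2 hp0)]
    refine le_trans (le_of_eq ?_) ((hN j k).trans (le_of_eq (by ring)))
    rw [norm_sub_rev]
    rfl
  -- Both geometric series sum to `2`: column `k` of `1 - N` has norm at most `(1 / 2) ^ k / 4`, and
  -- adding the columns gives `1 / 2`. The Neumann series then inverts `N`.
  have hnorm : ‖1 - N‖ ≤ 1 / 2 := by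
    refine ContinuousLinearMap.opNorm_le_bound _ (by norm_num) fun a => ?_
    have h1 := (lp.hasSum_single hp a).mapL (1 - N)
    have h2 := hgeom.mul_right (‖a‖ / 4)
    refine (h1.norm_le_of_bounded h2 fun k => ?_).trans (le_of_eq (by ring))
    have h3 : lp.single p k (a k) = a k • lp.single (E := fun _ : ℕ => ℂ) p k 1 := by
      rw [← lp.single_smul]; simp
    rw [h3, map_smul, norm_smul]
    calc ‖a k‖ * ‖(1 - N) (lp.single p k 1)‖ ≤ ‖a‖ * ((1 / 2) ^ k / 4) :=
          mul_le_mul (lp.norm_apply_le_norm hp0 a k) (hcol k) (norm_nonneg _) (norm_nonneg _)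
      _ = _ := by ring
  have hu : IsUnit N := by
    have := isUnit_one_sub_of_norm_lt_one (hnorm.trans_lt (by norm_num))
    rwa [sub_sub_cancel] at this
  obtain ⟨N', hN'⟩ := hu.exists_left_inv
  exact ⟨N', fun a => DFunLike.congr_fun hN' a⟩

/-- A compact operator is strictly singular. -/
theorem isStrictlySingular_of_isCompactOperator {T : X →L[ℂ] Y} (hT : IsCompactOperator T) :
    IsStrictlySingular T := by
  rintro E - hE ⟨e, he⟩
  -- The Riesz lemma gives a bounded sequence in `E` with mutual distances at least `1`. Its image
  -- has a Cauchy subsequence, which the bounded inverse would carry back to one in `E`.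
  obtain ⟨R, f, -, hfR, hf⟩ := exists_seq_norm_le_one_le_norm_sub (𝕜 := ℂ) hE
  obtain ⟨K, hK, hKT⟩ := hT.image_closedBall_subset_compact (𝕜₁ := ℂ) (f := (T : X →ₗ[ℂ] Y)) R
  obtain ⟨y, -, φ, hφ, hy⟩ := hK.tendsto_subseq (x := fun n => T (f n : X))
    (fun n => hKT ⟨f n, by simpa using hfR n, rfl⟩)
  have hcau := hy.cauchySeq
  have hc : 0 < ‖(e.symm : E.map (T : X →ₗ[ℂ] Y) →L[ℂ] E)‖ + 1 := by positivity
  rw [Metric.cauchySeq_iff'] at hcau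
  obtain ⟨M, hM⟩ := hcau _ (inv_pos.2 hc)
  have h1 := hM (M + 1) (Nat.le_succ M)
  have h2 := hf (hφ (Nat.lt_succ_self M)).ne'
  set x := f (φ (M + 1)) - f (φ M) with hx
  have h3 : ‖e x‖ < (‖(e.symm : E.map (T : X →ₗ[ℂ] Y) →L[ℂ] E)‖ + 1)⁻¹ := by
    rw [← Submodule.norm_coe, he, hx, Submodule.coe_sub, map_sub, ← dist_eq_norm]
    exact h1
  have h4 : ‖x‖ ≤ ‖(e.symm : E.map (T : X →ₗ[ℂ] Y) →L[ℂ] E)‖ * ‖e x‖ := by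
    have := (e.symm : E.map (T : X →ₗ[ℂ] Y) →L[ℂ] E).le_opNorm (e x)
    simpa using this
  have h5 : ‖(e.symm : E.map (T : X →ₗ[ℂ] Y) →L[ℂ] E)‖ *
      (‖(e.symm : E.map (T : X →ₗ[ℂ] Y) →L[ℂ] E)‖ + 1)⁻¹ < 1 := by
    rw [← div_eq_mul_inv, div_lt_one hc]
    exact lt_add_one _
  have h6 := mul_le_mul_of_nonneg_left h3.le
    (norm_nonneg (e.symm : E.map (T : X →ₗ[ℂ] Y) →L[ℂ] E))
  linarith

theorem linearIndependent_lp_single (p : ℝ≥0∞) :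
    LinearIndependent ℂ fun i : ℕ => lp.single (E := fun _ : ℕ => ℂ) p i 1 := by
  rw [linearIndependent_iff']
  intro s g hg i hi
  have := congrFun (congrArg (fun a : lp (fun _ : ℕ => ℂ) p => (a : ℕ → ℂ)) hg) i
  dsimp only at this
  rw [lp.coeFn_sum] at this
  have h2 := (Finset.sum_apply i s fun j => (g j • lp.single (E := fun _ : ℕ => ℂ) p j 1 :
    ℕ → ℂ)).symm.trans this
  simpa [Pi.single_apply, hi] using h2

/-- A strictly singular operator does not preserve a copy of `ℓ_p`. -/
theorem not_preservesComplementedCopy_of_isStrictlySingular {p : ℝ≥0∞} [Fact (1 ≤ p)]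
    {T : X →L[ℂ] Y} (hT : IsStrictlySingular T) : ¬ PreservesComplementedCopy p T := by
  rintro ⟨E, ⟨e⟩, hE, -, -⟩
  -- Completeness passes from `ℓ_p` to `E` and makes `E` closed, which strict singularity asks for.
  have hcomp : CompleteSpace E := by
    exact (completeSpace_congr (e := e.toEquiv) e.isUniformEmbedding).2 inferInstance
  refine hT E (completeSpace_coe_iff_isComplete.1 hcomp).isClosed (fun hfin => ?_) hE
  have : FiniteDimensional ℂ (lp (fun _ : ℕ => ℂ) p) := e.toLinearEquiv.finiteDimensional
  exact not_finite_iff_infinite.2 inferInstance (linearIndependent_lp_single p).finite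

end Factorization

/-! ### Finite-rank approximation and norming functionals. -/

namespace SchattenClass

variable {H : Type*} [NormedAddCommGroup H] [InnerProductSpace ℂ H] [CompleteSpace H]
variable {p : ℝ≥0∞} [Fact (1 ≤ p)]

/-- The matrix coefficient `X ↦ ⟪y, X x⟫` as a functional on `S_p(H)`. -/
def coeff (y x : H) : SchattenClass p H →L[ℂ] ℂ :=
  (innerSL ℂ y) ∘L (ContinuousLinearMap.apply ℂ H x) ∘L toOperatorL

@[simp] theorem coeff_apply (y x : H) (X : SchattenClass p H) :
    coeff y x X = ⟪y, X.toOperator x⟫_ℂ := rfl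

/-- If `X` lives on the orthogonal complement of `S`, then so do its singular vectors. -/
theorem exists_schmidt_tail (hp : p ≠ ∞) {S : Finset H} {X : SchattenClass p H}
    (hX : tail S X = X) :
    ∃ u v : ℕ → H, IsOrthoSystem u ∧ IsOrthoSystem v ∧
      (∀ n, ⟪v n, X.toOperator (u n)⟫_ℂ = singularValue X.toOperator n) ∧
      (∀ n, tailProj S (u n) = u n) ∧ (∀ n, tailProj S (v n) = v n) ∧
      HasSum (fun i => (singularValue X.toOperator i : ℂ) •
        (rankOne (v i) (u i) : SchattenClass p H)) X := by
  obtain ⟨u, v, hu, hv, hXu, hd, h0, hsum⟩ := exists_schmidt_hasSum hp X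
  refine ⟨u, v, hu, hv, hd, fun n => ?_, fun n => ?_, hsum⟩
  · by_cases hs : singularValue X.toOperator n = 0
    · rw [(h0 n hs).1, map_zero]
    have hs' : (singularValue X.toOperator n : ℂ) ≠ 0 := by exact_mod_cast hs
    refine tailProj_eq_self fun a ha => ?_
    -- For `a` in `S` the coefficient `⟪v n, X a⟫` vanishes, since `X` is its own tail. By the
    -- singular value expansion it equals `s n * ⟪u n, a⟫`, with `s n` nonzero in this case.
    have h1 : HasSum (fun i => ⟪v n, ((singularValue X.toOperator i : ℂ) •
        (rankOne (v i) (u i) : SchattenClass p H)).toOperator a⟫_ℂ) ⟪v n, X.toOperator a⟫_ℂ :=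
      hsum.mapL (coeff (v n) a)
    have h2 : ⟪v n, X.toOperator a⟫_ℂ = 0 := by
      rw [← hX, toOperator_tail_apply, tailProj_eq_zero ha]; simp
    have h3 := h1.unique (hasSum_single n fun i hi => by
      rw [map_smul, smul_apply, toOperator_rankOne, InnerProductSpace.rankOne_apply,
        inner_smul_right, inner_smul_right, hv.1 n i hi.symm]; simp)
    have h4 := hd n
    rw [hXu, inner_smul_right] at h4
    rw [h2, map_smul, smul_apply, toOperator_rankOne, InnerProductSpace.rankOne_apply,
      inner_smul_right, inner_smul_right] at h3
    have h5 : (singularValue X.toOperator n : ℂ) * ⟪u n, a⟫_ℂ = 0 := by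
      linear_combination -h3 - ⟪u n, a⟫_ℂ * h4
    rw [← inner_conj_symm, (mul_eq_zero.1 h5).resolve_left hs', map_zero]
  · by_cases hs : singularValue X.toOperator n = 0
    · rw [(h0 n hs).2, map_zero]
    have hs' : (singularValue X.toOperator n : ℂ) ≠ 0 := by exact_mod_cast hs
    refine tailProj_eq_self fun a ha => ?_
    have h1 : ⟪a, X.toOperator (u n)⟫_ℂ = 0 := by
      rw [← hX, toOperator_tail_apply, ← inner_tailProj_left, tailProj_eq_zero ha,
        inner_zero_left]
    rw [hXu, inner_smul_right] at h1
    exact (mul_eq_zero.1 h1).resolve_left hs'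

theorem sum_singularValue_rpow_le (hp : p ≠ ∞) (X : SchattenClass p H) (m : ℕ) :
    ∑ i : Fin m, ‖(singularValue X.toOperator i : ℂ)‖ ^ p.toReal ≤ ‖X‖ ^ p.toReal := by
  rw [norm_rpow_eq_tsum hp]
  simp only [Complex.norm_real, Real.norm_of_nonneg (singularValue_nonneg _ _)]
  rw [← Finset.sum_range fun i => singularValue X.toOperator i ^ p.toReal]
  exact (X.summable_singularValue hp).sum_le_tsum _ fun i _ =>
    Real.rpow_nonneg (singularValue_nonneg _ _) _

/-- A finite-rank approximation from the singular value decomposition. -/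
theorem exists_finite_schmidt_tail (hp : p ≠ ∞) {S : Finset H} {X : SchattenClass p H}
    (hX : tail S X = X) {η : ℝ} (hη : 0 < η) :
    ∃ (m : ℕ) (u v : Fin m → H) (s : Fin m → ℂ), IsOrthoSystem u ∧ IsOrthoSystem v ∧
      (∀ i, tailProj S (u i) = u i) ∧ (∀ i, tailProj S (v i) = v i) ∧
      (∀ i, ⟪v i, X.toOperator (u i)⟫_ℂ = s i) ∧
      ∑ i, ‖s i‖ ^ p.toReal ≤ ‖X‖ ^ p.toReal ∧
      ‖X - ∑ i, s i • (rankOne (v i) (u i) : SchattenClass p H)‖ < η := by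
  obtain ⟨u, v, hu, hv, hd, hSu, hSv, hsum⟩ := exists_schmidt_tail hp hX
  obtain ⟨m, hm⟩ := (Metric.tendsto_nhds.1 hsum.tendsto_sum_nat η hη).exists
  refine ⟨m, u ∘ Fin.val, v ∘ Fin.val, fun i => singularValue X.toOperator i,
    hu.comp Fin.val_injective, hv.comp Fin.val_injective, fun i => hSu i, fun i => hSv i,
    fun i => hd i, sum_singularValue_rpow_le hp X m, ?_⟩
  rw [dist_comm, dist_eq_norm, Finset.sum_range] at hm
  exact hm

/-- A functional on `S_p(H)` given by finitely many matrix coefficients, norming `Z` up to a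
constant on the orthogonal complement of `S`. -/
theorem exists_norming_functional (hp : p ≠ ∞) (S : Finset H) (Z : SchattenClass p H) {δ : ℝ}
    (hδ : 0 < δ) (hZ : δ ≤ ‖tail S Z‖) :
    ∃ (n : ℕ) (x y : Fin n → H) (φ : SchattenClass p H →L[ℂ] ℂ),
      IsOrthoSystem x ∧ IsOrthoSystem y ∧ (∀ i, tailProj S (x i) = x i) ∧
      (∀ i, tailProj S (y i) = y i) ∧ φ Z = 1 ∧
      ∀ X, ‖φ X‖ ^ p.toReal ≤
        (2 / δ) ^ p.toReal * ∑ i, ‖⟪y i, X.toOperator (x i)⟫_ℂ‖ ^ p.toReal := by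
  have hr := toReal_pos_of_ne_top hp
  have hp0 : p ≠ 0 := (zero_lt_one.trans_le (Fact.out (p := 1 ≤ p))).ne'
  obtain ⟨n, x, y, s, hx, hy, hSx, hSy, hd, -, happ⟩ :=
    exists_finite_schmidt_tail hp (tail_tail_of_subset (Finset.Subset.refl S) Z) (half_pos hδ)
  have hcoef : ∀ i, ⟪y i, Z.toOperator (x i)⟫_ℂ = s i := fun i => by
    rw [← hd, toOperator_tail_apply, ← inner_tailProj_left, hSx, hSy]
  -- Finite diagonals become vectors of a finite-dimensional `ℓ_p`. The truncated singular values
  -- `s` have norm at least `δ / 2` there, and a Hahn–Banach functional norming `z s`, divided by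
  -- `‖z s‖`, gives `φ`.
  let z : (Fin n → ℂ) → lp (fun _ : Fin n => ℂ) p := fun c => ∑ i, lp.single p i (c i)
  have hz : ∀ c, ‖z c‖ ^ p.toReal = ∑ i, ‖c i‖ ^ p.toReal := fun c =>
    lp.norm_sum_single hr (E := fun _ : Fin n => ℂ) c Finset.univ
  have hzn : δ / 2 ≤ ‖z s‖ := by
    have h1 : ‖∑ i, s i • (rankOne (y i) (x i) : SchattenClass p H)‖ ≤ ‖z s‖ :=
      norm_sum_smul_rankOne_le hp hx hy s (norm_nonneg _) (hz s).ge
    have h2 := norm_sub_norm_le (tail S Z)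
      (∑ i, s i • (rankOne (y i) (x i) : SchattenClass p H))
    linarith
  have hz0 : 0 < ‖z s‖ := by linarith
  obtain ⟨g, hg1, hg⟩ := exists_dual_vector ℂ (z s) hz0.ne'
  have hgz : ∀ c, g (z c) = ∑ i, c i * g (lp.single (E := fun _ : Fin n => ℂ) p i 1) := by
    intro c
    rw [map_sum]
    refine Finset.sum_congr rfl fun i _ => ?_
    have h3 : lp.single p i (c i) = c i • lp.single (E := fun _ : Fin n => ℂ) p i 1 := by
      rw [← lp.single_smul]; simp
    rw [h3, map_smul, smul_eq_mul]
  have hφ : ∀ X : SchattenClass p H, (((‖z s‖⁻¹ : ℝ) : ℂ) • ∑ i,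
      g (lp.single (E := fun _ : Fin n => ℂ) p i 1) • coeff (y i) (x i)) X
      = ((‖z s‖⁻¹ : ℝ) : ℂ) * g (z fun i => ⟪y i, X.toOperator (x i)⟫_ℂ) := by
    intro X
    rw [hgz, smul_apply, smul_eq_mul, sum_apply]
    congr 1
    refine Finset.sum_congr rfl fun i _ => ?_
    rw [smul_apply, coeff_apply, smul_eq_mul, mul_comm]
  refine ⟨n, x, y, _, hx, hy, hSx, hSy, (hφ Z).trans ?_, fun X => ?_⟩
  · simp only [hcoef]
    rw [hg]
    simp [hz0.ne']
  · rw [hφ, ← hz, ← Real.mul_rpow (by positivity) (norm_nonneg _)]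
    refine Real.rpow_le_rpow (norm_nonneg _) ?_ hr.le
    rw [norm_mul, Complex.norm_real, norm_inv, norm_norm]
    refine mul_le_mul ?_ ?_ (norm_nonneg _) (by positivity)
    · rw [inv_le_comm₀ hz0 (by positivity), inv_div]; exact hzn
    · have := g.le_opNorm (z fun i => ⟪y i, X.toOperator (x i)⟫_ℂ)
      rwa [hg1, one_mul] at this

end SchattenClass

/-- Concatenating the blocks into one system lets the `ℓ_p` inequalities act on all blocks at once.
-/
theorem isOrthoSystem_sigma {H : Type*} [NormedAddCommGroup H] [InnerProductSpace ℂ H] {n : ℕ → ℕ}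
    (e : ∀ k, Fin (n k) → H) (he : ∀ k, IsOrthoSystem (e k))
    (h : ∀ k l, k < l → ∀ i j, ⟪e k i, e l j⟫_ℂ = 0) (F : Finset ℕ) :
    IsOrthoSystem fun z : Σ k : F, Fin (n k) => e z.1 z.2 := by
  refine ⟨?_, fun z => (he _).2 _⟩
  rintro ⟨⟨k, hk⟩, i⟩ ⟨⟨l, hl⟩, j⟩ hne
  rcases lt_trichotomy k l with hkl | rfl | hkl
  · exact h k l hkl i j
  · exact (he k).1 i j fun hij => hne (by rw [hij])
  · rw [← inner_conj_symm, h l k hkl j i, map_zero]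

theorem norm_apply_le_of_norm_lt_div {X Y : Type*} [NormedAddCommGroup X] [NormedSpace ℂ X]
    [NormedAddCommGroup Y] [NormedSpace ℂ Y] (L : X →L[ℂ] Y) {x : X} {a : ℝ}
    (h : ‖x‖ < a / (‖L‖ + 1)) : ‖L x‖ ≤ a := by
  rw [lt_div_iff₀ (by positivity)] at h
  refine (L.le_opNorm _).trans ?_
  nlinarith [norm_nonneg x]

/-! ### The gliding hump. -/

namespace SchattenClass

variable {H : Type*} [NormedAddCommGroup H] [InnerProductSpace ℂ H] [CompleteSpace H]
variable {p : ℝ≥0∞} [Fact (1 ≤ p)]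

/-- A finite-rank element of `S_p(H)` together with a functional given by finitely many matrix
coefficients. -/
structure Block (p : ℝ≥0∞) [Fact (1 ≤ p)] (H : Type*) [NormedAddCommGroup H]
    [InnerProductSpace ℂ H] [CompleteSpace H] where
  /-- The precision with which the block is decoupled from its predecessors. -/
  index : ℕ
  /-- The rank of the operator. -/
  rank : ℕ
  /-- The right singular vectors. -/
  u : Fin rank → H
  /-- The left singular vectors. -/
  v : Fin rank → H
  /-- The singular values. -/
  s : Fin rank → ℂ
  /-- The number of matrix coefficients. -/
  corank : ℕ
  /-- The columns of the matrix coefficients. -/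
  x : Fin corank → H
  /-- The rows of the matrix coefficients. -/
  y : Fin corank → H
  /-- The functional. -/
  φ : SchattenClass p H →L[ℂ] ℂ

namespace Block

/-- The operator of a block. -/
def op (b : Block p H) : SchattenClass p H := ∑ i, b.s i • rankOne (b.v i) (b.u i)

/-- The operator of the block has norm at most `2`, and the functional has norm at most `K` and
takes the value `1` at the image of the operator. -/
structure IsNormalized (T : SchattenClass p H →L[ℂ] SchattenClass p H) (K : ℝ) (b : Block p H) :
    Prop where
  isOrthoSystem_u : IsOrthoSystem b.u
  isOrthoSystem_v : IsOrthoSystem b.v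
  isOrthoSystem_x : IsOrthoSystem b.x
  isOrthoSystem_y : IsOrthoSystem b.y
  sum_le : ∑ i, ‖b.s i‖ ^ p.toReal ≤ 2 ^ p.toReal
  norm_le : ∀ X, ‖b.φ X‖ ^ p.toReal ≤
    K ^ p.toReal * ∑ i, ‖⟪b.y i, X.toOperator (b.x i)⟫_ℂ‖ ^ p.toReal
  apply_op : b.φ (T b.op) = 1

/-- The block `b'` is orthogonal to `b` and almost decoupled from it under `T`. -/
structure IsDecoupled (T : SchattenClass p H →L[ℂ] SchattenClass p H) (b b' : Block p H) :
    Prop where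
  index_lt : b.index < b'.index
  inner_u : ∀ i j, ⟪b.u i, b'.u j⟫_ℂ = 0
  inner_v : ∀ i j, ⟪b.v i, b'.v j⟫_ℂ = 0
  inner_x : ∀ i j, ⟪b.x i, b'.x j⟫_ℂ = 0
  inner_y : ∀ i j, ⟪b.y i, b'.y j⟫_ℂ = 0
  norm_left_le : ‖b.φ (T b'.op)‖ ≤ (1 / 4) ^ b'.index / 8
  norm_right_le : ‖b'.φ (T b.op)‖ ≤ (1 / 4) ^ b'.index / 8

end Block

/-- Beyond all finite-dimensional subspaces there are normalized blocks for a noncompact positive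
map. -/
theorem exists_block (hp : p ≠ ∞) {T : SchattenClass p H →L[ℂ] SchattenClass p H}
    {δ : ℝ} (hδ : 0 < δ) {ι : Type*} [Fintype ι]
    (h : ∀ (S S' : Finset H) (Ψ : SchattenClass p H →L[ℂ] (ι → ℂ)), ∀ ε > 0, ∃ C : SchattenClass p H,
      tail S C = C ∧ ‖C‖ ≤ 2 ∧ ‖Ψ C‖ ≤ ε ∧ δ ≤ ‖tail S' (T C)‖)
    (k : ℕ) (S S' : Finset H) (Ψ : SchattenClass p H →L[ℂ] (ι → ℂ))
    {ε : ℝ} (hε : 0 < ε) :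
    ∃ b : Block p H, b.IsNormalized T (4 / δ) ∧ b.index = k ∧
      (∀ i, tailProj S (b.u i) = b.u i) ∧ (∀ i, tailProj S (b.v i) = b.v i) ∧
      (∀ i, tailProj S' (b.x i) = b.x i) ∧ (∀ i, tailProj S' (b.y i) = b.y i) ∧
      ‖Ψ b.op‖ ≤ ε := by
  obtain ⟨C, hSC, hC, hΨ, hT⟩ := h S S' Ψ (ε / 2) (by positivity)
  have hη : 0 < min (ε / 2 / (‖Ψ‖ + 1)) (δ / 2 / (‖T‖ + 1)) := by positivity
  obtain ⟨m, u, v, s, hu, hv, hSu, hSv, -, hs, happ⟩ := exists_finite_schmidt_tail hp hSC hη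
  have h1 := norm_apply_le_of_norm_lt_div Ψ (happ.trans_le (min_le_left _ _))
  have h2 := norm_apply_le_of_norm_lt_div T (happ.trans_le (min_le_right _ _))
  set D : SchattenClass p H := ∑ i, s i • (rankOne (v i) (u i) : SchattenClass p H) with hD
  have h3 : δ / 2 ≤ ‖tail S' (T D)‖ := by
    have e1 := norm_tail_le S' (T (C - D))
    have e2 : tail S' (T C) = tail S' (T (C - D)) + tail S' (T D) := by
      rw [← map_add, ← map_add, sub_add_cancel]
    rw [e2] at hT
    linarith [norm_add_le (tail S' (T (C - D))) (tail S' (T D))]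
  obtain ⟨n, x, y, φ, hx, hy, hSx, hSy, hφ1, hφ⟩ :=
    exists_norming_functional hp S' (T D) (half_pos hδ) h3
  -- The finite-rank truncation costs half of `δ`, and the norming functional costs another factor
  -- `2`.
  have hK : 2 / (δ / 2) = 4 / δ := by field_simp; norm_num
  refine ⟨⟨k, m, u, v, s, n, x, y, φ⟩, ⟨hu, hv, hx, hy, ?_, fun X => ?_, hφ1⟩, rfl, hSu, hSv,
    hSx, hSy, ?_⟩
  · exact hs.trans (Real.rpow_le_rpow (norm_nonneg _) hC (toReal_pos_of_ne_top hp).le)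
  · rw [← hK]; exact hφ X
  · change ‖Ψ D‖ ≤ ε
    have e2 : Ψ D = Ψ C - Ψ (C - D) := by rw [← map_sub, sub_sub_cancel]
    rw [e2]
    linarith [norm_sub_le (Ψ C) (Ψ (C - D))]

/-- The coefficients defining `b.φ` use only vectors orthogonal to `S`, so the functional cannot
distinguish `X` from its tail. A new functional is therefore tiny on old images whose tails are
tiny. -/
theorem norm_apply_le_norm_tail (hp : p ≠ ∞) {T : SchattenClass p H →L[ℂ] SchattenClass p H}
    {K : ℝ} (hK : 0 ≤ K) {b : Block p H} (hb : b.IsNormalized T K) {S : Finset H}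
    (hx : ∀ i, tailProj S (b.x i) = b.x i) (hy : ∀ i, tailProj S (b.y i) = b.y i)
    (X : SchattenClass p H) : ‖b.φ X‖ ≤ K * ‖tail S X‖ := by
  have hr := toReal_pos_of_ne_top hp
  rw [← Real.rpow_le_rpow_iff (norm_nonneg _) (by positivity) hr,
    Real.mul_rpow hK (norm_nonneg _)]
  refine (hb.norm_le X).trans (mul_le_mul_of_nonneg_left ?_ (by positivity))
  refine le_trans (le_of_eq (Finset.sum_congr rfl fun i _ => ?_))
    ((tail S X).sum_norm_inner_rpow_le hp hb.isOrthoSystem_x hb.isOrthoSystem_y)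
  rw [toOperator_tail_apply, ← inner_tailProj_left, hx, hy]

/-- A noncompact positive map has an infinite sequence of almost decoupled blocks. -/
theorem exists_block_sequence (hp : p ≠ ∞)
    {T : SchattenClass p H →L[ℂ] SchattenClass p H} (hT : IsPositiveMap T)
    (hnc : ¬ IsCompactOperator T) :
    ∃ K : ℝ, 0 < K ∧ ∃ b : ℕ → Block p H, (∀ n, (b n).IsNormalized T K) ∧
      ∀ m n, m < n → (b m).IsDecoupled T (b n) := by
  classical
  obtain ⟨δ, hδ, h⟩ := exists_le_norm_tail_of_not_isCompactOperator hp hT hnc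
  have hK : 0 < 4 / δ := by positivity
  refine ⟨4 / δ, hK, exists_seq_of_forall_finset_exists _ _ fun F hF => ?_⟩
  -- The new index exceeds all earlier ones, so indices grow along the sequence and the errors `(1 /
  -- 4) ^ k / 8` decrease.
  set k := F.sup Block.index + 1 with hk
  set ε : ℝ := (1 / 4) ^ k / 8 with hε
  have hε0 : 0 < ε := by positivity
  choose S₀ hS₀ using fun X : SchattenClass p H =>
    exists_norm_tail_lt hp X (ε := ε / (4 / δ)) (by positivity)
  set S : Finset H := F.biUnion fun b => Finset.univ.image b.u ∪ Finset.univ.image b.v with hS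
  -- The sets `S₀ (T b.op)` make the tails of the old images small, which controls new functionals
  -- on old images. Old functionals on the new image are controlled by taking them, composed with
  -- `T`, as the components of `Ψ`.
  set S' : Finset H := F.biUnion fun b => (Finset.univ.image b.x ∪ Finset.univ.image b.y) ∪
    S₀ (T b.op) with hS'
  obtain ⟨b', hb', hidx, hu, hv, hx, hy, hΨ⟩ := exists_block hp hδ
    (fun S S' Ψ => h S S' F Ψ) k S S'
    (ContinuousLinearMap.pi fun b => b.1.φ ∘L T) hε0
  have horth : ∀ (R : Finset H) (a z : H), a ∈ R → tailProj R z = z → ⟪a, z⟫_ℂ = 0 := by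
    intro R a z ha hz
    rw [← hz, ← inner_tailProj_left, tailProj_eq_zero ha, inner_zero_left]
  refine ⟨b', hb', fun b hb => ⟨?_, fun i j => ?_, fun i j => ?_, fun i j => ?_, fun i j => ?_,
    ?_, ?_⟩⟩
  · rw [hidx, hk]
    exact Nat.lt_succ_of_le (Finset.le_sup (f := Block.index) hb)
  · exact horth S _ _ (Finset.mem_biUnion.2 ⟨b, hb, by simp⟩) (hu j)
  · exact horth S _ _ (Finset.mem_biUnion.2 ⟨b, hb, by simp⟩) (hv j)
  · exact horth S' _ _ (Finset.mem_biUnion.2 ⟨b, hb, by simp⟩) (hx j)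
  · exact horth S' _ _ (Finset.mem_biUnion.2 ⟨b, hb, by simp⟩) (hy j)
  · rw [hidx]
    exact (norm_le_pi_norm (ContinuousLinearMap.pi (fun b : F => b.1.φ ∘L T) b'.op)
      ⟨b, hb⟩).trans hΨ
  · rw [hidx]
    refine (norm_apply_le_norm_tail hp hK.le hb' hx hy _).trans ?_
    have hsub : S₀ (T b.op) ⊆ S' :=
      Finset.subset_union_right.trans (Finset.subset_biUnion_of_mem
        (fun b : Block p H => (Finset.univ.image b.x ∪ Finset.univ.image b.y) ∪ S₀ (T b.op)) hb)
    have := (hS₀ (T b.op) S' hsub).le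
    rwa [le_div_iff₀' hK] at this

/-- A noncompact positive map on `S_p(H)` preserves a complemented copy of `ℓ_p`. -/
theorem preservesComplementedCopy_of_not_isCompactOperator (hp : p ≠ ∞)
    {T : SchattenClass p H →L[ℂ] SchattenClass p H} (hT : IsPositiveMap T)
    (hnc : ¬ IsCompactOperator T) : PreservesComplementedCopy p T := by
  classical
  have hr := toReal_pos_of_ne_top hp
  have := completeSpace (H := H) hp
  obtain ⟨K, hK, b, hb, hdec⟩ := exists_block_sequence hp hT hnc
  have hu := isOrthoSystem_sigma (fun k => (b k).u) (fun k => (hb k).isOrthoSystem_u)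
    fun k l hkl => (hdec k l hkl).inner_u
  have hv := isOrthoSystem_sigma (fun k => (b k).v) (fun k => (hb k).isOrthoSystem_v)
    fun k l hkl => (hdec k l hkl).inner_v
  have hx := isOrthoSystem_sigma (fun k => (b k).x) (fun k => (hb k).isOrthoSystem_x)
    fun k l hkl => (hdec k l hkl).inner_x
  have hy := isOrthoSystem_sigma (fun k => (b k).y) (fun k => (hb k).isOrthoSystem_y)
    fun k l hkl => (hdec k l hkl).inner_y
  -- A combination of blocks is one diagonal operator with entries `c k * s i`. Each block
  -- contributes at most `‖c k‖ ^ p * 2 ^ p`, hence the constant `2`.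
  obtain ⟨J, hJ, -⟩ := exists_lp_map hp (fun k => (b k).op) zero_le_two fun F c M hM hc => by
    have h1 := norm_sum_smul_rankOne_le (p := p) hp (hu F) (hv F)
      (fun z => c z.1 * (b z.1).s z.2) (M := 2 * M) (by positivity) (by
        rw [Fintype.sum_sigma]
        simp only [norm_mul, Real.mul_rpow (norm_nonneg _) (norm_nonneg _)]
        rw [Real.mul_rpow zero_le_two hM, mul_comm (2 ^ p.toReal)]
        calc _ ≤ ∑ k : F, ‖c k‖ ^ p.toReal * 2 ^ p.toReal := Finset.sum_le_sum fun k _ => by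
              rw [← Finset.mul_sum]
              exact mul_le_mul_of_nonneg_left (hb k).sum_le (by positivity)
          _ = (∑ k ∈ F, ‖c k‖ ^ p.toReal) * 2 ^ p.toReal := by
              rw [← Finset.sum_mul, Finset.sum_coe_sort F fun k => ‖c k‖ ^ p.toReal]
          _ ≤ _ := mul_le_mul_of_nonneg_right hc (by positivity))
    rw [Fintype.sum_sigma] at h1
    rw [← Finset.sum_coe_sort]
    refine le_trans (le_of_eq (congrArg _ (Finset.sum_congr rfl fun k _ => ?_))) h1
    simp only [Block.op, Finset.smul_sum, smul_smul]
  have hφ : ∀ (X : SchattenClass p H) (F : Finset ℕ),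
      ∑ k ∈ F, ‖(b k).φ X‖ ^ p.toReal ≤ (K * ‖X‖) ^ p.toReal := by
    intro X F
    have h1 := X.sum_norm_inner_rpow_le hp (hx F) (hy F)
    rw [Fintype.sum_sigma] at h1
    rw [Real.mul_rpow hK.le (norm_nonneg _), ← Finset.sum_coe_sort]
    calc ∑ k : F, ‖(b k).φ X‖ ^ p.toReal ≤ _ := Finset.sum_le_sum fun k _ => (hb k).norm_le X
      _ = _ := (Finset.mul_sum _ _ _).symm
      _ ≤ _ := mul_le_mul_of_nonneg_left h1 (by positivity)
  let L : SchattenClass p H →L[ℂ] lp (fun _ : ℕ => ℂ) p := LinearMap.mkContinuous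
    { toFun := fun X => ⟨fun k => (b k).φ X, memℓp_gen' (hφ X)⟩
      map_add' := fun X Y => by ext k; exact map_add (b k).φ X Y
      map_smul' := fun c X => by ext k; exact map_smul (b k).φ c X } K fun X =>
      lp.norm_le_of_forall_sum_le hr (by positivity) (hφ X)
  have hL : ∀ X k, L X k = (b k).φ X := fun X k => rfl
  have hJs : ∀ k, J (lp.single p k 1) = (b k).op := by
    intro k
    refine (hJ (lp.single p k 1)).unique ?_
    have h := hasSum_single (f := fun j => lp.single (E := fun _ : ℕ => ℂ) p k 1 j • (b j).op) k
      fun j hj => by rw [lp.single_apply_ne _ _ _ hj, zero_smul]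
    rwa [lp.single_apply_self, one_smul] at h
  have hidx : ∀ n, n ≤ (b n).index := by
    intro n
    induction n with
    | zero => exact Nat.zero_le _
    | succ n ih => exact Nat.succ_le_of_lt (ih.trans_lt (hdec n _ n.lt_succ_self).index_lt)
  -- An off-diagonal entry is bounded through the larger of its two positions `n`; there `(1 / 4) ^
  -- n` splits into two factors `(1 / 2) ^ n`, one for the row and one for the column.
  have hpow : ∀ j k n : ℕ, j ≤ n → k ≤ n →
      (1 / 4 : ℝ) ^ (b n).index / 8 ≤ (1 / 2) ^ j * (1 / 2) ^ k / 8 := by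
    intro j k n hj hk
    have h1 : (1 / 4 : ℝ) ^ (b n).index ≤ (1 / 4) ^ n :=
      pow_le_pow_of_le_one (by norm_num) (by norm_num) (hidx n)
    have h2 : (1 / 4 : ℝ) ^ n = (1 / 2) ^ n * (1 / 2) ^ n := by rw [← mul_pow]; norm_num
    have h3 : (1 / 2 : ℝ) ^ n ≤ (1 / 2) ^ j :=
      pow_le_pow_of_le_one (by norm_num) (by norm_num) hj
    have h4 : (1 / 2 : ℝ) ^ n ≤ (1 / 2) ^ k :=
      pow_le_pow_of_le_one (by norm_num) (by norm_num) hk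
    have h5 := mul_le_mul h3 h4 (by positivity) (by positivity)
    linarith
  -- Entry `(j, k)` of `L T J` is the `j`-th functional at the image of the `k`-th operator. A left
  -- inverse of this matrix, absorbed into `L`, completes the factorization.
  obtain ⟨N', hN'⟩ := exists_comp_eq_id_of_norm_sub_le hp (L ∘L T ∘L J) fun j k => by
    change ‖L (T (J (lp.single p k 1))) j - _‖ ≤ _
    rw [hL, hJs]
    rcases lt_trichotomy j k with hjk | rfl | hjk
    · rw [Pi.single_eq_of_ne hjk.ne, sub_zero]
      exact (hdec j k hjk).norm_left_le.trans (hpow j k k hjk.le le_rfl)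
    · rw [(hb j).apply_op, Pi.single_eq_same, sub_self, norm_zero]
      positivity
    · rw [Pi.single_eq_of_ne hjk.ne', sub_zero]
      exact (hdec k j hjk).norm_right_le.trans (hpow j k j le_rfl hjk.le)
  exact preservesComplementedCopy_of_comp_eq_id T J (N' ∘L L) hN'

end SchattenClass

end Schatten

end

theorem theorem4p10 (p : ℝ≥0∞) [Fact (1 ≤ p)] (hp : p ≠ ∞)
    {H : Type*} [NormedAddCommGroup H] [InnerProductSpace ℂ H] [CompleteSpace H]
    [TopologicalSpace.SeparableSpace H]
    (T : Schatten.SchattenClass p H →L[ℂ] Schatten.SchattenClass p H)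
    (hT : Schatten.IsPositiveMap T) :
    List.TFAE [
      IsCompactOperator T,
      Schatten.IsStrictlySingular T,
      ¬ Schatten.PreservesComplementedCopy p T] := by
  tfae_have 1 → 2 := Schatten.isStrictlySingular_of_isCompactOperator
  tfae_have 2 → 3 := Schatten.not_preservesComplementedCopy_of_isStrictlySingular
  tfae_have 3 → 1 := fun h => by
    by_contra hnc
    exact h (Schatten.SchattenClass.preservesComplementedCopy_of_not_isCompactOperator hp hT hnc)
  tfae_finish
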